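/- Let $n\ge 2$, let $U\in C^\infty([0,\infty),\mathbb R)$ with $U\ge 0$, and for $z\in\mathbb S^{n-1}$, $\psi\in(0,\pi/2]$ let $$S(z,\psi)=\{z+r\omega \mid r\ge 0,\ \omega\in\mathbb S^{n-1},\ -\langle\omega,z\rangle=\cos\psi\},\qquad (\mathcal C f)(z,\psi)=\int_{S(z,\psi)} f(x)\,U(\|x-z\|)\,dS(x),$$ where $f$ is a smooth real function on $\mathbb R^n$ with compact support in the open unit ball $B_1(0)$ and $dS$ is the surface measure (the weighted conical Radon transform). Let $Y_{\ell,k}$, $\ell\in\mathbb N_0$, $1\le k\le N(n,\ell)$, be real spherical harmonics of degree $\ell$ forming a complete orthonormal system in $L^2(\mathbb S^{n-1})$, where $N(n,\ell)$ is the dimension of the space of spherical harmonics of degree $\ell$. Let $$f_{\ell,k}(\rho)=\int_{\mathbb S^{n-1}} f(\rho\theta)Y_{\ell,k}(\theta)\,dS(\theta),\qquad (\mathcal C f)_{\ell,k}(\psi)=\int_{\mathbb S^{n-1}}(\mathcal C f)(z,\psi)Y_{\ell,k}(z)\,dS(z)$$ be the coefficients of the expansions of $f(\rho\,\cdot)$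 and $(\mathcal C f)(\cdot,\psi)$ in this system. Let $C^\mu_\ell$ denote the Gegenbauer polynomials normalized by $C^\mu_\ell(1)=1$ (for $\mu=0$, the Chebyshev polynomials of the first kind). For every $(\ell,k)$ put - $\hat g_{\ell,k}(t)=|\mathbb S^{n-2}|^{-1}(1-t)^{-(n-2)/2}\,(\mathcal C f)_{\ell,k}(\arccos\sqrt t)$ for $t\in[0,1)$; - $\hat f_{\ell,k}(s)=\tfrac12 f_{\ell,k}(\sqrt{1-s})$; - $\displaystyle F_\ell(t,s)=\sum_{\sigma=\pm1}\sigma^\ell\,U\bigl(\sqrt t-\sigma\sqrt{t-s}\bigr)\bigl(\sqrt t-\sigma\sqrt{t-s}\bigr)^{n-2}\,C_\ell^{(n-2)/2}\!\left(\frac{\sqrt t\sqrt{t-s}+\sigma(1-t)}{\sqrt{1-s}}\right).$ Then for every $t\in[0,1]$ the function $s\mapsto \hat f_{\ell,k}(s)F_\ell(t,s)/\sqrt{t-s}$ is integrable on $(0,t)$, and $$\hat g_{\ell,k}(t)=\int_0^t \hat f_{\ell,k}(s)\,\frac{F_\ell(t,s)}{\sqrt{t-s}}\,ds\qquad\text{for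 all } t\in[0,1],$$ where $\hat g_{\ell,k}(1)$ is understood as $\lim_{t\to1^-}\hat g_{\ell,k}(t)$, and this limit exists. -/

import Mathlib

open MeasureTheory Set Filter Topology
open scoped ContDiff

noncomputable section

/-- Euclidean space `ℝⁿ`. -/
abbrev EucSp (n : ℕ) := EuclideanSpace ℝ (Fin n)

/-- The unit sphere `S^{n-1}` of `ℝⁿ`. -/
abbrev UnitSphere (n : ℕ) := Metric.sphere (0 : EucSp n) 1

/-- The (non-normalized) surface measure on the unit sphere `S^{n-1}` of `ℝⁿ`. -/
def sphereMeasure (n : ℕ) : Measure (UnitSphere n) :=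
  (volume : Measure (EucSp n)).toSphere

/-- The total surface measure `|S^{d-1}|` of the unit sphere of `ℝᵈ`. -/
def sphereArea (d : ℕ) : ℝ := (sphereMeasure d).real univ

/-! ### Spherical harmonics -/

/-- The Laplacian `∑ᵢ ∂ᵢ²` on real polynomials in `n` variables. -/
def polyLaplacian (n : ℕ) : MvPolynomial (Fin n) ℝ →ₗ[ℝ] MvPolynomial (Fin n) ℝ :=
  ∑ i : Fin n, (MvPolynomial.pderiv (R := ℝ) i).toLinearMap ∘ₗ
    (MvPolynomial.pderiv (R := ℝ) i).toLinearMap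

/-- The space of harmonic homogeneous polynomials of degree `ℓ` in `n` variables. -/
def harmonicPoly (n ℓ : ℕ) : Submodule ℝ (MvPolynomial (Fin n) ℝ) :=
  MvPolynomial.homogeneousSubmodule (Fin n) ℝ ℓ ⊓ LinearMap.ker (polyLaplacian n)

/-- `N(n,ℓ)`, the dimension of the space of spherical harmonics of degree `ℓ` on `S^{n-1}`. -/
def numHarm (n ℓ : ℕ) : ℕ := Module.finrank ℝ (harmonicPoly n ℓ)

/-- A spherical harmonic of degree `ℓ`: the restriction to the unit sphere of a harmonic
homogeneous polynomial of degree `ℓ`. -/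
def IsSphericalHarmonic (n ℓ : ℕ) (Y : UnitSphere n → ℝ) : Prop :=
  ∃ p ∈ harmonicPoly n ℓ, ∀ θ : UnitSphere n,
    Y θ = MvPolynomial.eval (fun i => (θ : EucSp n) i) p

/-- `Y ℓ k`, for `ℓ ∈ ℕ` and `N(n,ℓ)` values of `k`, are spherical harmonics of degree `ℓ` forming
a complete orthonormal system of `L²(S^{n-1})`. -/
structure IsSphericalHarmonicBasis (n : ℕ)
    (Y : (ℓ : ℕ) → Fin (numHarm n ℓ) → UnitSphere n → ℝ) : Prop where
  harmonic : ∀ ℓ k, IsSphericalHarmonic n ℓ (Y ℓ k)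
  orthonormal : ∀ i j : (Σ ℓ : ℕ, Fin (numHarm n ℓ)),
    ∫ θ, Y i.1 i.2 θ * Y j.1 j.2 θ ∂(sphereMeasure n) = if i = j then 1 else 0
  complete : ∀ u : UnitSphere n → ℝ, MemLp u 2 (sphereMeasure n) →
    (∀ ℓ k, ∫ θ, u θ * Y ℓ k θ ∂(sphereMeasure n) = 0) → u =ᵐ[sphereMeasure n] 0

/-- The coefficient of `u` along `Y`, i.e. the `L²(S^{n-1})` inner product of `u` and `Y`. For an
orthonormal system this is the coefficient of `Y` in the expansion of `u`. -/
def sphCoeff {n : ℕ} (Y u : UnitSphere n → ℝ) : ℝ :=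
  ∫ θ, u θ * Y θ ∂(sphereMeasure n)

/-! ### Gegenbauer polynomials -/

/-- The Gegenbauer polynomials `C^μ_ℓ`, normalized such that `C^μ_ℓ(1) = 1`, through their
three-term recurrence
`(ℓ + 2μ) C_{ℓ+1}(x) = 2 (ℓ + μ) x C_ℓ(x) - ℓ C_{ℓ-1}(x)`.
For `μ = 0` these are the Chebyshev polynomials of the first kind. -/
def gegenbauer (μ : ℝ) : ℕ → ℝ → ℝ
  | 0, _ => 1
  | 1, x => x
  | ℓ + 2, x =>
    (2 * (ℓ + 1 + μ) * x * gegenbauer μ (ℓ + 1) x - (ℓ + 1) * gegenbauer μ ℓ x)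
      / (ℓ + 1 + 2 * μ)

/-- The normalization `C^μ_ℓ(1) = 1`. -/
theorem gegenbauer_one {μ : ℝ} (hμ : 0 ≤ μ) : ∀ ℓ : ℕ, gegenbauer μ ℓ 1 = 1
  | 0 => rfl
  | 1 => rfl
  | ℓ + 2 => by
    have h : (ℓ : ℝ) + 1 + 2 * μ ≠ 0 := by positivity
    rw [gegenbauer, gegenbauer_one hμ ℓ, gegenbauer_one hμ (ℓ + 1)]
    field_simp
    ring

/-! ### The weighted conical Radon transform -/

/-- The half cone `S(z,ψ)` with vertex `z`, central axis `-z` and half opening angle `ψ`. -/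
def coneSurface {n : ℕ} (z : EucSp n) (ψ : ℝ) : Set (EucSp n) :=
  {x | ∃ r : ℝ, 0 ≤ r ∧ ∃ w : EucSp n, ‖w‖ = 1 ∧ -inner ℝ w z = Real.cos ψ ∧ x = z + r • w}

/-- The hyperplane through the origin orthogonal to `z`. -/
abbrev orthHyperplane {n : ℕ} (z : EucSp n) : Submodule ℝ (EucSp n) := (Submodule.span ℝ {z})ᗮ

/-- The point over `y` of the graph of `h : z^⊥ → ℝ`, for a unit vector `z`. -/
def graphPoint {n : ℕ} (z : EucSp n) (h : orthHyperplane z → ℝ) (y : orthHyperplane z) : EucSp n :=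
  (y : EucSp n) + h y • z

/-- The surface measure on the hypersurface `{y + h(y) z | y ∈ z^⊥}`, the graph of a Lipschitz
function `h` over the hyperplane orthogonal to the unit vector `z`: the surface element is
`dS = √(1 + |∇h(y)|²) dy`. -/
def graphSurfaceMeasure {n : ℕ} (z : EucSp n) (h : orthHyperplane z → ℝ) : Measure (EucSp n) :=
  ((volume : Measure (orthHyperplane z)).withDensity
    (fun y => ENNReal.ofReal (Real.sqrt (1 + ‖fderiv ℝ h y‖ ^ 2)))).map (graphPoint z h)

/-- The function `h(y) = 1 - |y| cot ψ` on `z^⊥`, whose graph is the cone `S(z,ψ)` if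
`0 < ψ ≤ π/2`; see `coneSurface_eq_range`. -/
def coneHeight {n : ℕ} (z : EucSp n) (ψ : ℝ) (y : orthHyperplane z) : ℝ :=
  1 - ‖y‖ * Real.cot ψ

theorem coneSurface_eq_range {n : ℕ} (hn : 2 ≤ n) {z : EucSp n} (hz : ‖z‖ = 1) {ψ : ℝ}
    (h0 : 0 < ψ) (h1 : ψ ≤ Real.pi / 2) :
    coneSurface z ψ = range (graphPoint z (coneHeight z ψ)) := by
  have hs : 0 < Real.sin ψ := Real.sin_pos_of_pos_of_lt_pi h0 (by linarith [Real.pi_pos])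
  have hcs := Real.sin_sq_add_cos_sq ψ
  have hzz : inner ℝ z z = (1 : ℝ) := by rw [real_inner_self_eq_norm_sq, hz]; norm_num
  have hortho : ∀ y : orthHyperplane z, inner ℝ (y : EucSp n) z = (0 : ℝ) := fun y =>
    (Submodule.mem_orthogonal' _ _).1 y.2 z (Submodule.mem_span_singleton_self z)
  ext x
  constructor
  · rintro ⟨r, hr, w, hw, hc, rfl⟩
    have hmem : w + Real.cos ψ • z ∈ orthHyperplane z := by
      rw [Submodule.mem_orthogonal_singleton_iff_inner_left, inner_add_left, inner_smul_left, hzz]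
      simp; linarith
    have hnorm : ‖w + Real.cos ψ • z‖ = Real.sin ψ := by
      rw [← sq_eq_sq₀ (norm_nonneg _) hs.le, norm_add_sq_real, norm_smul, inner_smul_right, hw, hz]
      have : inner ℝ w z = -Real.cos ψ := by linarith
      rw [this, Real.norm_eq_abs, mul_one, sq_abs]
      nlinarith
    refine ⟨r • ⟨_, hmem⟩, ?_⟩
    have : ‖(r • (⟨_, hmem⟩ : orthHyperplane z))‖ = r * Real.sin ψ := by
      rw [norm_smul, Real.norm_eq_abs, abs_of_nonneg hr]
      exact congrArg _ hnorm
    rw [graphPoint, coneHeight, this, Real.cot_eq_cos_div_sin,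
      show r * Real.sin ψ * (Real.cos ψ / Real.sin ψ) = r * Real.cos ψ by field_simp]
    simp only [Submodule.coe_smul]
    module
  · rintro ⟨y, rfl⟩
    obtain ⟨e, he, hy⟩ : ∃ e : orthHyperplane z, ‖e‖ = 1 ∧ y = ‖y‖ • e := by
      by_cases hy : y = 0
      · have : Nontrivial (orthHyperplane z) := by
          have h2 := (Submodule.span ℝ {z}).finrank_add_finrank_orthogonal
          rw [finrank_span_singleton (by rintro rfl; simp at hz), finrank_euclideanSpace_fin] at h2
          have h3 : 0 < Module.finrank ℝ (orthHyperplane z) := by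
            change 0 < Module.finrank ℝ ((Submodule.span ℝ {z})ᗮ : Submodule ℝ (EucSp n))
            omega
          exact Module.nontrivial_of_finrank_pos h3
        obtain ⟨e, he⟩ := exists_norm_eq (orthHyperplane z) zero_le_one
        exact ⟨e, he, by simp [hy]⟩
      · have : ‖y‖ ≠ 0 := norm_ne_zero_iff.2 hy
        exact ⟨‖y‖⁻¹ • y, by rw [norm_smul, norm_inv, norm_norm, inv_mul_cancel₀ this],
          by rw [smul_smul, mul_inv_cancel₀ this, one_smul]⟩
    have he' : ‖(e : EucSp n)‖ = 1 := he
    refine ⟨‖y‖ / Real.sin ψ, by positivity,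
      Real.sin ψ • (e : EucSp n) - Real.cos ψ • z, ?_, ?_, ?_⟩
    · rw [← sq_eq_sq₀ (norm_nonneg _) zero_le_one, norm_sub_sq_real, norm_smul, norm_smul,
        inner_smul_left, inner_smul_right, hortho, he', hz]
      simp
    · rw [inner_sub_left, inner_smul_left, inner_smul_left, hortho, hzz]
      simp
    · have hy' : (y : EucSp n) = ‖y‖ • (e : EucSp n) := congrArg Subtype.val hy
      rw [graphPoint, coneHeight, Real.cot_eq_cos_div_sin, smul_sub, smul_smul, smul_smul,
        div_mul_cancel₀ _ hs.ne', ← hy', mul_div_assoc', div_mul_eq_mul_div]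
      module

/-- The weighted conical Radon transform
`(𝒞f)(z,ψ) = ∫_{S(z,ψ)} f(x) U(|x - z|) dS(x)`, for `z ∈ S^{n-1}` and `0 < ψ ≤ π/2`
(for `ψ = 0` the cone degenerates to a ray and is not a hypersurface). -/
def conicalRadon {n : ℕ} (U : ℝ → ℝ) (f : EucSp n → ℝ) (z : EucSp n) (ψ : ℝ) : ℝ :=
  ∫ x in coneSurface z ψ, f x * U ‖x - z‖ ∂(graphSurfaceMeasure z (coneHeight z ψ))

/-- The coefficient function `f_{ℓ,k}(ρ)` of `θ ↦ f(ρ θ)` along `Y = Y_{ℓ,k}`. -/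
def radialCoeff {n : ℕ} (Y : UnitSphere n → ℝ) (f : EucSp n → ℝ) (ρ : ℝ) : ℝ :=
  sphCoeff Y (fun θ => f (ρ • (θ : EucSp n)))

/-- The coefficient function `(𝒞f)_{ℓ,k}(ψ)` of `z ↦ (𝒞f)(z,ψ)` along `Y = Y_{ℓ,k}`. -/
def radonCoeff {n : ℕ} (Y : UnitSphere n → ℝ) (U : ℝ → ℝ) (f : EucSp n → ℝ) (ψ : ℝ) : ℝ :=
  sphCoeff Y (fun z => conicalRadon U f (z : EucSp n) ψ)

/-! ### The rescaled functions and the kernel -/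

/-- `ĝ(t) = |S^{n-2}|⁻¹ (1-t)^{-(n-2)/2} (𝒞f)_{ℓ,k}(arccos √t)`. -/
def gHat {n : ℕ} (Y : UnitSphere n → ℝ) (U : ℝ → ℝ) (f : EucSp n → ℝ) (t : ℝ) : ℝ :=
  (sphereArea (n - 1))⁻¹ * (1 - t) ^ (-((n : ℝ) - 2) / 2) *
    radonCoeff Y U f (Real.arccos (Real.sqrt t))

/-- `f̂(s) = f_{ℓ,k}(√(1-s)) / 2`. -/
def fHat {n : ℕ} (Y : UnitSphere n → ℝ) (f : EucSp n → ℝ) (s : ℝ) : ℝ :=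
  radialCoeff Y f (Real.sqrt (1 - s)) / 2

/-- The kernel `F_ℓ(t,s)`. -/
def abelKernel (n : ℕ) (U : ℝ → ℝ) (ℓ : ℕ) (t s : ℝ) : ℝ :=
  ∑ σ ∈ ({1, -1} : Finset ℝ),
    σ ^ ℓ * U (Real.sqrt t - σ * Real.sqrt (t - s)) *
      (Real.sqrt t - σ * Real.sqrt (t - s)) ^ (n - 2) *
      gegenbauer (((n : ℝ) - 2) / 2) ℓ
        ((Real.sqrt t * Real.sqrt (t - s) + σ * (1 - t)) / Real.sqrt (1 - s))

end

/-!
The conical Radon transform commutes with rotations, so by Schur's lemma it acts on the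
spherical harmonics of degree `ℓ` through a radial kernel. The proof makes this concrete by
averaging over the orthogonal group `O(n)` with its invariant probability measure `dg`.

Fix a coordinate vector `e`. The surface measure on the sphere is, up to the factor `|S^{n-1}|`, the
image of `dg` under `g ↦ g e` (`integral_sphere_eq_integral_ortho`), and the cone with vertex `g e`
is the image under `g` of the cone with vertex `e`. Parametrizing that cone by the hyperplane `e^⊥`
and exchanging the integrals reduces the coefficient of the transform to
`∫ f (g x) Y (g e) dg` for the points `x` of one fixed cone. By invariance this equals
`C_ℓ(⟨x,e⟩ / |x|) ∫ f (|x| g e) Y (g e) dg` (`integral_ortho_pair`), where `C_ℓ` is the Gegenbauer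
polynomial; the last integral is `f_{ℓ,k}(|x|) / |S^{n-1}|`. What remains is radial on `e^⊥`, and
polar coordinates give a one-dimensional integral over the distance `r` to the vertex
(`radonCoeff_eq_integral_radial`).

The Gegenbauer polynomial enters because `w ↦ ∫ Φ (g e) p (g w) dg`, for a harmonic polynomial `p`,
is again a harmonic homogeneous polynomial, invariant under the stabilizer of `e`. Such a polynomial
has the form `∑ c_j X_a^(ℓ-2j) (∑_{i ≠ a} X_i²)^j`; harmonicity is a two-term recursion for the
`c_j`, and its solution is the expansion of `C_ℓ` in powers of `x` and `1 - x²`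
(`eval_eq_gegenbauer_of_axial`, `gegenbauer_eq_sum`).

Finally, with `√t = cos ψ` the points of the cone at the distances `r = √t ∓ v` from the vertex have
the same norm `√(1 - t + v²)`. Folding the integral over `r` at `√t` and substituting `s = t - v²`
yields the Abel-type equation. In the variable `v` the integrand is uniformly bounded, since the
argument of `C_ℓ` lies in `[-1,1]`; this gives integrability and, by dominated convergence, the limit
`t → 1`.
-/

noncomputable section

/-! ### Expansion of the Gegenbauer polynomials -/

/-- The coefficient `∏_{i<j} (2i+1)/(2i+1+2μ)`. -/
def zonalWeight (μ : ℝ) (j : ℕ) : ℝ :=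
  ∏ i ∈ Finset.range j, ((2 * i + 1 : ℝ) / (2 * i + 1 + 2 * μ))

theorem zonalWeight_succ (μ : ℝ) (j : ℕ) :
    zonalWeight μ (j + 1) = zonalWeight μ j * ((2 * j + 1 : ℝ) / (2 * j + 1 + 2 * μ)) := by
  rw [zonalWeight, Finset.prod_range_succ, zonalWeight]

/-- The coefficients of `x^(ℓ-2j) (1-x²)^j` in the Gegenbauer polynomial of degree `ℓ`. -/
def zonalCoeff (μ : ℝ) (ℓ j : ℕ) : ℝ := (-1) ^ j * ℓ.choose (2 * j) * zonalWeight μ j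

theorem choose_mul_pow_sub_mul (ℓ k : ℕ) (x : ℝ) :
    (ℓ.choose k : ℝ) * x ^ (ℓ + 1 - k) = x * (ℓ.choose k * x ^ (ℓ - k)) := by
  by_cases h : k ≤ ℓ
  · rw [Nat.succ_sub h, pow_succ]; ring
  · rw [Nat.choose_eq_zero_of_lt (not_le.1 h)]; simp

theorem choose_succ_mul_cast (ℓ k : ℕ) :
    (ℓ.choose (k + 1) : ℝ) * (k + 1) = ℓ.choose k * (ℓ - k) := by
  have h3 : ((ℓ.choose (k + 1) * (k + 1) : ℕ) : ℝ) = _ :=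
    congrArg Nat.cast (Nat.choose_succ_right_eq ℓ k)
  push_cast at h3
  rw [h3]
  by_cases h : k ≤ ℓ
  · rw [Nat.cast_sub h]
  · rw [Nat.choose_eq_zero_of_lt (not_le.1 h)]; simp

theorem zonalCoeff_eq_zero {μ : ℝ} {ℓ j : ℕ} (h : ℓ < 2 * j) : zonalCoeff μ ℓ j = 0 := by
  simp [zonalCoeff, Nat.choose_eq_zero_of_lt h]

/-- The coefficients of `x^(ℓ-2j) (1-x²)^j` in the three-term recurrence, where the term of degree `ℓ`
has been multiplied by `x² + (1 - x²) = 1`. -/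
theorem zonalCoeff_rec {μ : ℝ} (hμ : 0 ≤ μ) (ℓ j : ℕ) :
    (ℓ + 1 + 2 * μ) * zonalCoeff μ (ℓ + 2) (j + 1) =
      2 * (ℓ + 1 + μ) * zonalCoeff μ (ℓ + 1) (j + 1) -
        (ℓ + 1) * (zonalCoeff μ ℓ (j + 1) + zonalCoeff μ ℓ j) := by
  have e1 : ((ℓ + 1).choose (2 * j + 2) : ℝ) =
      ℓ.choose (2 * j + 1) + ℓ.choose (2 * j + 2) := by
    rw [Nat.choose_succ_succ]; push_cast; ring
  have e2 : ((ℓ + 2).choose (2 * j + 2) : ℝ) =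
      ℓ.choose (2 * j) + 2 * ℓ.choose (2 * j + 1) + ℓ.choose (2 * j + 2) := by
    rw [Nat.choose_succ_succ, Nat.choose_succ_succ, Nat.choose_succ_succ]; push_cast; ring
  have r1 := choose_succ_mul_cast ℓ (2 * j)
  push_cast at r1
  have hd : (2 * j + 1 + 2 * μ : ℝ) ≠ 0 := by positivity
  simp only [zonalCoeff, zonalWeight_succ, show 2 * (j + 1) = 2 * j + 2 by ring, pow_succ, e1, e2]
  field_simp
  linear_combination (-2 * μ * zonalWeight μ j) * r1

theorem zonalCoeff_zero (μ : ℝ) (ℓ : ℕ) : zonalCoeff μ ℓ 0 = 1 := by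
  simp [zonalCoeff, zonalWeight]

/-- The Gegenbauer polynomial as a homogeneous expression in `x` and `1 - x²`. -/
theorem gegenbauer_eq_sum {μ : ℝ} (hμ : 0 ≤ μ) (x : ℝ) : ∀ ℓ N : ℕ, ℓ < 2 * N →
    gegenbauer μ ℓ x =
      ∑ j ∈ Finset.range N, zonalCoeff μ ℓ j * x ^ (ℓ - 2 * j) * (1 - x ^ 2) ^ j
  | 0, N, hN => by
    obtain ⟨M, rfl⟩ : ∃ M, N = M + 1 := ⟨N - 1, by omega⟩
    rw [Finset.sum_range_succ', Finset.sum_eq_zero]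
    · simp [zonalCoeff_zero, gegenbauer]
    · intro j _
      rw [zonalCoeff_eq_zero (by omega)]; simp
  | 1, N, hN => by
    obtain ⟨M, rfl⟩ : ∃ M, N = M + 1 := ⟨N - 1, by omega⟩
    rw [Finset.sum_range_succ', Finset.sum_eq_zero]
    · simp [zonalCoeff_zero, gegenbauer]
    · intro j _
      rw [zonalCoeff_eq_zero (by omega)]; simp
  | ℓ + 2, N, hN => by
    obtain ⟨M, rfl⟩ : ∃ M, N = M + 1 := ⟨N - 1, by omega⟩
    have hd : (ℓ + 1 + 2 * μ : ℝ) ≠ 0 := by positivity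
    have i0 := gegenbauer_eq_sum hμ x ℓ M (by omega)
    have i1 := gegenbauer_eq_sum hμ x ℓ (M + 1) (by omega)
    have i2 := gegenbauer_eq_sum hμ x (ℓ + 1) (M + 1) (by omega)
    -- `x² + (1 - x²) = 1` makes the last term of the recurrence homogeneous of degree `ℓ + 2`.
    have key : gegenbauer μ ℓ x = x ^ 2 * gegenbauer μ ℓ x + (1 - x ^ 2) * gegenbauer μ ℓ x := by
      ring
    rw [gegenbauer, div_eq_iff hd, key]
    nth_rw 1 [i1]
    rw [i0, i2, Finset.sum_range_succ', Finset.sum_range_succ', Finset.sum_range_succ']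
    simp only [zonalCoeff_zero]
    have hterm : ∀ j, zonalCoeff μ (ℓ + 2) (j + 1) * x ^ (ℓ + 2 - 2 * (j + 1)) *
        (1 - x ^ 2) ^ (j + 1) * (ℓ + 1 + 2 * μ) =
        2 * (ℓ + 1 + μ) * x * (zonalCoeff μ (ℓ + 1) (j + 1) * x ^ (ℓ + 1 - 2 * (j + 1)) *
          (1 - x ^ 2) ^ (j + 1)) -
        (ℓ + 1) * (x ^ 2 * (zonalCoeff μ ℓ (j + 1) * x ^ (ℓ - 2 * (j + 1)) *
          (1 - x ^ 2) ^ (j + 1))) -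
        (ℓ + 1) * ((1 - x ^ 2) * (zonalCoeff μ ℓ j * x ^ (ℓ - 2 * j) * (1 - x ^ 2) ^ j)) := by
      intro j
      have h := zonalCoeff_rec hμ ℓ j
      have p1 := choose_mul_pow_sub_mul (ℓ + 1) (2 * (j + 1)) x
      have q1 : zonalCoeff μ (ℓ + 1) (j + 1) * x ^ (ℓ + 2 - 2 * (j + 1)) =
          x * (zonalCoeff μ (ℓ + 1) (j + 1) * x ^ (ℓ + 1 - 2 * (j + 1))) := by
        simp only [zonalCoeff]; linear_combination (-1) ^ (j + 1) * zonalWeight μ (j + 1) * p1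
      have q2 : zonalCoeff μ ℓ (j + 1) * x ^ (ℓ + 2 - 2 * (j + 1)) =
          x ^ 2 * (zonalCoeff μ ℓ (j + 1) * x ^ (ℓ - 2 * (j + 1))) := by
        by_cases hj : 2 * (j + 1) ≤ ℓ
        · rw [show ℓ + 2 - 2 * (j + 1) = ℓ - 2 * (j + 1) + 2 by omega, pow_add]; ring
        · rw [zonalCoeff_eq_zero (by omega)]; simp
      have e : ℓ + 2 - 2 * (j + 1) = ℓ - 2 * j := by omega
      rw [e] at q1 q2 ⊢
      linear_combination x ^ (ℓ - 2 * j) * (1 - x ^ 2) ^ (j + 1) * h +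
        2 * (ℓ + 1 + μ) * (1 - x ^ 2) ^ (j + 1) * q1 - (ℓ + 1) * (1 - x ^ 2) ^ (j + 1) * q2
    have hsum := Finset.sum_congr (rfl : Finset.range M = Finset.range M) fun j _ => hterm j
    simp only [Finset.sum_sub_distrib, ← Finset.mul_sum, ← Finset.sum_mul] at hsum
    simp only [mul_zero, Nat.sub_zero, pow_zero]
    linear_combination -hsum

/-! ### Zonal harmonic polynomials -/

theorem polyLaplacian_apply (n : ℕ) (p : MvPolynomial (Fin n) ℝ) :
    polyLaplacian n p = ∑ i, MvPolynomial.pderiv i (MvPolynomial.pderiv i p) := by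
  simp [polyLaplacian, LinearMap.sum_apply]

theorem pderiv_natCast {n : ℕ} (a : Fin n) (m : ℕ) :
    MvPolynomial.pderiv a (m : MvPolynomial (Fin n) ℝ) = 0 := by
  rw [← MvPolynomial.C_eq_coe_nat]
  exact MvPolynomial.pderiv_C

/-- The squared distance `∑_{i ≠ a} Xᵢ²` from the `a`-th coordinate axis. -/
def axisDistSq {n : ℕ} (a : Fin n) : MvPolynomial (Fin n) ℝ :=
  ∑ i ∈ Finset.univ.erase a, MvPolynomial.X i ^ 2

theorem pderiv_axisDistSq_self {n : ℕ} (a : Fin n) :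
    MvPolynomial.pderiv a (axisDistSq a) = 0 := by
  rw [axisDistSq, map_sum]
  refine Finset.sum_eq_zero fun i hi => ?_
  rw [MvPolynomial.pderiv_pow, MvPolynomial.pderiv_X_of_ne (Finset.ne_of_mem_erase hi), mul_zero]

theorem pderiv_axisDistSq {n : ℕ} {a b : Fin n} (h : b ≠ a) :
    MvPolynomial.pderiv b (axisDistSq a) = 2 * MvPolynomial.X b := by
  rw [axisDistSq, map_sum, Finset.sum_eq_single b]
  · rw [MvPolynomial.pderiv_pow, MvPolynomial.pderiv_X_self]; simp
  · intro i _ hi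
    rw [MvPolynomial.pderiv_pow, MvPolynomial.pderiv_X_of_ne hi, mul_zero]
  · intro hb
    exact absurd (Finset.mem_erase.2 ⟨h, Finset.mem_univ b⟩) hb

/-- The Laplacian in cylindrical coordinates about the `a`-th axis. -/
theorem polyLaplacian_axial {n : ℕ} (a : Fin n) (m j : ℕ) :
    polyLaplacian n (MvPolynomial.X a ^ m * axisDistSq a ^ j) =
      ((m : MvPolynomial (Fin n) ℝ) * ((m - 1 : ℕ) : MvPolynomial (Fin n) ℝ)) * MvPolynomial.X a ^ (m - 2) * axisDistSq a ^ j +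
        MvPolynomial.X a ^ m * (4 * ((j : MvPolynomial (Fin n) ℝ) * ((j - 1 : ℕ) : MvPolynomial (Fin n) ℝ)) * axisDistSq a ^ (j - 2) * axisDistSq a +
          2 * (j : MvPolynomial (Fin n) ℝ) * ((n - 1 : ℕ) : MvPolynomial (Fin n) ℝ) * axisDistSq a ^ (j - 1)) := by
  rw [polyLaplacian_apply, ← Finset.add_sum_erase _ _ (Finset.mem_univ a)]
  congr 1
  · simp only [MvPolynomial.pderiv_mul, MvPolynomial.pderiv_pow, pderiv_axisDistSq_self,
      MvPolynomial.pderiv_X_self]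
    simp only [mul_one, mul_zero, add_zero, MvPolynomial.pderiv_mul, MvPolynomial.pderiv_pow,
      pderiv_axisDistSq_self, MvPolynomial.pderiv_X_self, pderiv_natCast]
    rw [show m - 1 - 1 = m - 2 by omega]
    ring
  · have h : ∀ b ∈ Finset.univ.erase a,
        MvPolynomial.pderiv b (MvPolynomial.pderiv b (MvPolynomial.X a ^ m * axisDistSq a ^ j)) =
        MvPolynomial.X a ^ m * (4 * ((j : MvPolynomial (Fin n) ℝ) * ((j - 1 : ℕ) : MvPolynomial (Fin n) ℝ)) * axisDistSq a ^ (j - 2)) *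
          MvPolynomial.X b ^ 2 + MvPolynomial.X a ^ m * (2 * (j : MvPolynomial (Fin n) ℝ) * axisDistSq a ^ (j - 1)) := by
      intro b hb
      have hba := Finset.ne_of_mem_erase hb
      simp only [MvPolynomial.pderiv_mul, MvPolynomial.pderiv_pow, pderiv_axisDistSq hba,
        MvPolynomial.pderiv_X_of_ne hba.symm]
      simp only [mul_zero, zero_mul, zero_add, MvPolynomial.pderiv_mul, MvPolynomial.pderiv_pow,
        pderiv_axisDistSq hba, MvPolynomial.pderiv_X_self, MvPolynomial.pderiv_X_of_ne hba.symm,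
        pderiv_natCast]
      rw [show j - 1 - 1 = j - 2 by omega, show (2 : MvPolynomial (Fin n) ℝ) = ((2 : ℕ) : _) by
        norm_num, pderiv_natCast]
      push_cast
      ring
    rw [Finset.sum_congr rfl h, Finset.sum_add_distrib, ← Finset.mul_sum, ← axisDistSq,
      Finset.sum_const, Finset.card_erase_of_mem (Finset.mem_univ a), Finset.card_univ,
      Fintype.card_fin, nsmul_eq_mul]
    ring

theorem eval_smul_of_isHomogeneous {n ℓ : ℕ} {P : MvPolynomial (Fin n) ℝ}
    (hP : P.IsHomogeneous ℓ) (c : ℝ) (v : Fin n → ℝ) :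
    MvPolynomial.eval (c • v) P = c ^ ℓ * MvPolynomial.eval v P := by
  rw [MvPolynomial.eval_eq', MvPolynomial.eval_eq', Finset.mul_sum]
  refine Finset.sum_congr rfl fun d hd => ?_
  have hdeg : ∑ i, d i = ℓ := by
    have := hP (MvPolynomial.mem_support_iff.1 hd)
    rw [← this, Finsupp.weight_apply, Finsupp.sum_fintype _ _ (by simp)]
    simp
  simp only [Pi.smul_apply, smul_eq_mul, mul_pow, Finset.prod_mul_distrib,
    Finset.prod_pow_eq_pow_sum, hdeg]
  ring

/-- A homogeneous polynomial that is invariant under the rotations about the `a`-th axis is a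
combination of the products `X_a^(ℓ-2j) (∑_{i ≠ a} Xᵢ²)^j`. -/
theorem exists_axial_expansion {n ℓ : ℕ} {a b : Fin n} (hab : a ≠ b)
    {P : MvPolynomial (Fin n) ℝ} (hP : P.IsHomogeneous ℓ)
    (hinv : ∀ v w : Fin n → ℝ, v a = w a → ∑ i, v i ^ 2 = ∑ i, w i ^ 2 →
      MvPolynomial.eval v P = MvPolynomial.eval w P) :
    ∃ c : ℕ → ℝ, (∀ j, ℓ < 2 * j → c j = 0) ∧ P = ∑ j ∈ Finset.range (ℓ / 2 + 1),
      MvPolynomial.C (c j) * (MvPolynomial.X a ^ (ℓ - 2 * j) * axisDistSq a ^ j) := by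
  classical
  -- Restrict `P` to the plane of the `a`-th and `b`-th axes, with `a`-th coordinate `1`: the result is
  -- an even polynomial `π(r) = κ(r²)`, and homogeneity and invariance recover `P` from `κ`.
  set q : Fin n → Polynomial ℝ := fun i => if i = a then 1 else if i = b then Polynomial.X else 0
  set π : Polynomial ℝ := MvPolynomial.aeval q P with hπ
  set u : ℝ → Fin n → ℝ := fun r i => if i = a then 1 else if i = b then r else 0 with hu
  have hπu : ∀ r, π.eval r = MvPolynomial.eval (u r) P := by
    intro r
    rw [hπ, ← Polynomial.coe_evalRingHom, MvPolynomial.map_aeval, MvPolynomial.eval]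
    congr 1
    ext i
    · simp
    · simp only [MvPolynomial.coe_eval₂Hom, MvPolynomial.eval₂_X, q, u]
      split_ifs <;> simp
  have husq : ∀ r, ∑ i, u r i ^ 2 = 1 + r ^ 2 := by
    intro r
    rw [← Finset.add_sum_erase _ _ (Finset.mem_univ a),
      Finset.sum_eq_single_of_mem b (Finset.mem_erase.2 ⟨hab.symm, Finset.mem_univ b⟩)]
    · simp [u, hab.symm]
    · intro i hi hib
      simp [u, hib, Finset.ne_of_mem_erase hi]
  have hua : ∀ r, u r a = 1 := fun r => by simp [u]
  have heven : ∀ r, π.eval (-r) = π.eval r := by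
    intro r
    rw [hπu, hπu]
    exact hinv _ _ (by rw [hua, hua]) (by rw [husq, husq]; ring)
  have hodd : ∀ i, ¬ 2 ∣ i → π.coeff i = 0 := by
    intro i hi
    have hcomp : π.comp (-Polynomial.X) = π := by
      apply Polynomial.funext
      intro r
      rw [Polynomial.eval_comp]; simpa using heven r
    have h1 := congrArg (fun s => Polynomial.coeff s i) hcomp
    rw [show (-Polynomial.X : Polynomial ℝ) = Polynomial.C (-1) * Polynomial.X by simp] at h1
    simp only [Polynomial.comp_C_mul_X_coeff] at h1
    rw [Odd.neg_one_pow (Nat.not_even_iff_odd.1 fun h => hi h.two_dvd)] at h1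
    linarith
  have hdeg : π.natDegree ≤ ℓ := by
    have := MvPolynomial.aeval_natDegree_le (n := 1) P hP.totalDegree_le q (by
      intro i; simp only [q]; split_ifs <;> simp)
    simpa using this
  set κ := Polynomial.contract 2 π with hκ
  have hκπ : Polynomial.expand ℝ 2 κ = π := by
    ext i
    rw [Polynomial.coeff_expand two_pos]
    split_ifs with h
    · rw [hκ, Polynomial.coeff_contract two_ne_zero, Nat.div_mul_cancel h]
    · rw [hodd i h]
  have hκ0 : ∀ j, ℓ < 2 * j → κ.coeff j = 0 := by
    intro j hj
    rw [hκ, Polynomial.coeff_contract two_ne_zero]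
    exact Polynomial.coeff_eq_zero_of_natDegree_lt (by omega)
  have hκe : ∀ r, π.eval r = ∑ j ∈ Finset.range (ℓ / 2 + 1), κ.coeff j * (r ^ 2) ^ j := by
    intro r
    rw [← hκπ, Polynomial.expand_eval]
    refine Polynomial.eval_eq_sum_range' ?_ _
    rw [Nat.lt_succ_iff, Polynomial.natDegree_le_iff_coeff_eq_zero]
    intro j hj
    exact hκ0 j (by omega)
  refine ⟨κ.coeff, hκ0, ?_⟩
  -- The factor `X_a` excludes the points with vanishing `a`-th coordinate.
  apply mul_left_cancel₀ (MvPolynomial.X_ne_zero (R := ℝ) a)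
  apply MvPolynomial.funext
  intro w
  rw [map_mul, map_mul, MvPolynomial.eval_X]
  by_cases hw : w a = 0
  · rw [hw, zero_mul, zero_mul]
  congr 1
  set d : ℝ := ∑ i ∈ Finset.univ.erase a, (w i) ^ 2 with hd
  have hd0 : 0 ≤ d / (w a) ^ 2 := by positivity
  have h1 : MvPolynomial.eval w P = w a ^ ℓ * MvPolynomial.eval (u (√(d / (w a) ^ 2))) P := by
    have h2 : MvPolynomial.eval w P = w a ^ ℓ * MvPolynomial.eval (fun i => w i / w a) P := by
      have hw' : w a • (fun i => w i / w a) = w := by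
        ext i
        simp only [Pi.smul_apply, smul_eq_mul]
        field_simp
      rw [← eval_smul_of_isHomogeneous hP, hw']
    rw [h2]
    congr 1
    apply hinv
    · rw [hua, div_self hw]
    · rw [husq, Real.sq_sqrt hd0, ← Finset.add_sum_erase _ _ (Finset.mem_univ a), div_self hw, hd,
        Finset.sum_div]
      simp [div_pow]
  rw [h1, ← hπu, hκe, Real.sq_sqrt hd0, map_sum, Finset.mul_sum]
  refine Finset.sum_congr rfl fun j hj => ?_
  have hj' : 2 * j ≤ ℓ := by have := Finset.mem_range.1 hj; omega
  obtain ⟨m, hm⟩ := Nat.exists_eq_add_of_le hj'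
  simp only [map_mul, map_pow, MvPolynomial.eval_C, MvPolynomial.eval_X, axisDistSq, map_sum, ← hd]
  rw [hm, Nat.add_sub_cancel_left, div_pow, pow_add, pow_mul]
  field_simp


theorem zonalCoeff_succ {μ : ℝ} (hμ : 0 ≤ μ) (ℓ j : ℕ) :
    zonalCoeff μ ℓ (j + 1) * ((2 * j + 2) * (2 * j + 1 + 2 * μ)) =
      -(zonalCoeff μ ℓ j * ((ℓ - 2 * j) * (ℓ - 2 * j - 1))) := by
  have r1 := choose_succ_mul_cast ℓ (2 * j)
  have r2 := choose_succ_mul_cast ℓ (2 * j + 1)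
  push_cast at r1 r2
  have hd : (2 * j + 1 + 2 * μ : ℝ) ≠ 0 := by positivity
  simp only [zonalCoeff, zonalWeight_succ, show 2 * (j + 1) = 2 * j + 1 + 1 by ring, pow_succ]
  field_simp
  linear_combination (-zonalWeight μ j * (2 * j + 1)) * r2 -
    zonalWeight μ j * (ℓ - 2 * j - 1) * r1

/-- Harmonicity as a recursion for the coefficients of an axially symmetric polynomial. -/
theorem axial_coeff_rec {n ℓ : ℕ} {a b : Fin n} (hab : a ≠ b) {c : ℕ → ℝ}
    (hc : ∀ j, ℓ < 2 * j → c j = 0)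
    (hΔ : polyLaplacian n (∑ j ∈ Finset.range (ℓ / 2 + 1),
      MvPolynomial.C (c j) * (MvPolynomial.X a ^ (ℓ - 2 * j) * axisDistSq a ^ j)) = 0) (j : ℕ) :
    c (j + 1) * ((2 * j + 2) * (2 * j + n - 1)) = -(c j * ((ℓ - 2 * j) * (ℓ - 2 * j - 1))) := by
  classical
  have hn : 1 ≤ n := by have := a.2; omega
  set J := ℓ / 2 with hJ
  set A : ℕ → ℝ := fun j =>
    c j * ((ℓ - 2 * j) * (ℓ - 2 * j - 1)) + c (j + 1) * ((2 * j + 2) * (2 * j + n - 1)) with hA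
  -- Evaluate the Laplacian at the points with `a`-th coordinate `1` at distance `r` from the axis.
  have hsum : ∀ r : ℝ, ∑ j ∈ Finset.range (J + 1), A j * (r ^ 2) ^ j = 0 := by
    intro r
    set u : Fin n → ℝ := fun i => if i = a then 1 else if i = b then r else 0 with hu
    have huN : MvPolynomial.eval u (axisDistSq a) = r ^ 2 := by
      rw [axisDistSq, map_sum,
        Finset.sum_eq_single_of_mem b (Finset.mem_erase.2 ⟨hab.symm, Finset.mem_univ b⟩)]
      · simp [u, hab.symm]
      · intro i hi hib
        simp [u, hib, Finset.ne_of_mem_erase hi]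
    have hua : u a = 1 := by simp [u]
    have h0 := congrArg (MvPolynomial.eval u) hΔ
    simp only [MvPolynomial.C_mul', map_sum, map_smul, polyLaplacian_axial,
      MvPolynomial.smul_eval, map_add, map_mul, map_pow, map_natCast, map_ofNat,
      MvPolynomial.eval_X, huN, hua, one_pow, map_zero] at h0
    have h1 : ∑ j ∈ Finset.range (J + 1), (c j * ((ℓ - 2 * j) * (ℓ - 2 * j - 1)) * (r ^ 2) ^ j +
        c j * (2 * j * (2 * j + n - 3)) * (r ^ 2) ^ (j - 1)) = 0 := by
      rw [← h0]
      refine Finset.sum_congr rfl fun j hj => ?_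
      have hj' : 2 * j ≤ ℓ := by have := Finset.mem_range.1 hj; omega
      have e1 : ((ℓ - 2 * j : ℕ) : ℝ) * ((ℓ - 2 * j - 1 : ℕ) : ℝ) =
          (ℓ - 2 * j) * (ℓ - 2 * j - 1) := by
        obtain ⟨m, hm⟩ := Nat.exists_eq_add_of_le hj'
        rw [hm, Nat.add_sub_cancel_left]
        cases m with
        | zero => simp
        | succ m => push_cast [Nat.add_sub_cancel]; ring
      have e2 : (j : ℝ) * ((j - 1 : ℕ) : ℝ) * (r ^ 2) ^ (j - 2) * r ^ 2 =
          j * (j - 1) * (r ^ 2) ^ (j - 1) := by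
        match j with
        | 0 => simp
        | 1 => simp
        | j + 2 =>
          rw [show j + 2 - 1 = j + 1 by omega, Nat.add_sub_cancel, pow_succ _ j]
          push_cast; ring
      rw [e1, Nat.cast_sub hn]
      push_cast
      linear_combination (-4 * c j) * e2
    rw [Finset.sum_add_distrib, Finset.sum_range_succ' (n := J)
      (f := fun j => c j * (2 * j * (2 * j + n - 3)) * (r ^ 2) ^ (j - 1))] at h1
    have hsplit : ∀ j, A j * (r ^ 2) ^ j = c j * ((ℓ - 2 * j) * (ℓ - 2 * j - 1)) * (r ^ 2) ^ j +
        c (j + 1) * ((2 * j + 2) * (2 * j + n - 1)) * (r ^ 2) ^ j := fun j => by rw [hA, add_mul]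
    simp only [hsplit, Finset.sum_add_distrib]
    rw [Finset.sum_range_succ (n := J)
      (f := fun j => c (j + 1) * ((2 * j + 2) * (2 * j + n - 1)) * (r ^ 2) ^ j),
      hc (J + 1) (by omega)]
    simp only [CharP.cast_eq_zero, zero_mul, mul_zero, add_zero, Nat.add_sub_cancel] at h1 ⊢
    rw [← h1, add_right_inj]
    refine Finset.sum_congr rfl fun j _ => ?_
    push_cast
    ring
  have hpoly : ∑ j ∈ Finset.range (J + 1), Polynomial.C (A j) * Polynomial.X ^ j = 0 := by
    refine Polynomial.eq_zero_of_infinite_isRoot _ ((Set.Ici_infinite (0 : ℝ)).mono fun s hs => ?_)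
    have := hsum (√s)
    rw [Real.sq_sqrt hs] at this
    simpa [Polynomial.IsRoot, Polynomial.eval_finsetSum] using this
  have hAj : A j = 0 := by
    by_cases hj : j < J + 1
    · have := congrArg (fun p => Polynomial.coeff p j) hpoly
      simpa [Polynomial.finsetSum_coeff, Polynomial.coeff_X_pow, Finset.mem_range, hj] using this
    · simp only [hA, hc j (by omega), hc (j + 1) (by omega)]; ring
  simp only [hA] at hAj
  linarith

/-- The zonal harmonic of degree `ℓ` is unique up to a factor and is given by the Gegenbauer
polynomial: a harmonic homogeneous polynomial that is invariant under the rotations about an axis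
is, on the unit sphere, a multiple of the Gegenbauer polynomial of the axis coordinate. -/
theorem eval_eq_gegenbauer_of_axial {n ℓ : ℕ} {a b : Fin n} (hab : a ≠ b)
    {P : MvPolynomial (Fin n) ℝ} (hP : P ∈ harmonicPoly n ℓ)
    (hinv : ∀ v w : Fin n → ℝ, v a = w a → ∑ i, v i ^ 2 = ∑ i, w i ^ 2 →
      MvPolynomial.eval v P = MvPolynomial.eval w P)
    {v : Fin n → ℝ} (hv : ∑ i, v i ^ 2 = 1) :
    MvPolynomial.eval v P =
      gegenbauer (((n : ℝ) - 2) / 2) ℓ (v a) * MvPolynomial.eval (Pi.single a 1) P := by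
  classical
  have hn : 2 ≤ n := by
    by_contra h
    have := a.2; have := b.2
    exact hab (Fin.ext (by omega))
  have hn' : (2 : ℝ) ≤ n := by exact_mod_cast hn
  have hμ : (0 : ℝ) ≤ ((n : ℝ) - 2) / 2 := by linarith
  obtain ⟨hhom, hΔ⟩ := hP
  rw [SetLike.mem_coe, MvPolynomial.mem_homogeneousSubmodule] at hhom
  rw [SetLike.mem_coe, LinearMap.mem_ker] at hΔ
  obtain ⟨c, hc, hPc⟩ := exists_axial_expansion hab hhom hinv
  rw [hPc] at hΔ
  have hrec := axial_coeff_rec hab hc hΔ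
  have hcj : ∀ j, c j = c 0 * zonalCoeff (((n : ℝ) - 2) / 2) ℓ j := by
    intro j
    induction j with
    | zero => rw [zonalCoeff_zero, mul_one]
    | succ j ih =>
      have h1 := hrec j
      have h2 := zonalCoeff_succ hμ ℓ j
      have hpos : ((2 * j + 2) * (2 * j + n - 1) : ℝ) ≠ 0 := by
        have : (0 : ℝ) ≤ j := j.cast_nonneg
        apply ne_of_gt
        apply mul_pos <;> linarith
      apply mul_right_cancel₀ hpos
      rw [h1, ih]
      linear_combination -c 0 * h2
  have hval : ∀ w : Fin n → ℝ, MvPolynomial.eval w P = c 0 *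
      ∑ j ∈ Finset.range (ℓ / 2 + 1), zonalCoeff (((n : ℝ) - 2) / 2) ℓ j *
        w a ^ (ℓ - 2 * j) * (∑ i, w i ^ 2 - w a ^ 2) ^ j := by
    intro w
    have hN : MvPolynomial.eval w (axisDistSq a) = ∑ i, w i ^ 2 - w a ^ 2 := by
      rw [← Finset.add_sum_erase _ _ (Finset.mem_univ a), axisDistSq, map_sum]
      simp
    conv_lhs => rw [hPc]
    rw [map_sum, Finset.mul_sum]
    refine Finset.sum_congr rfl fun j _ => ?_
    simp only [map_mul, map_pow, MvPolynomial.eval_C, MvPolynomial.eval_X, hN, hcj j]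
    ring
  have hsingle : ∑ i, (Pi.single a 1 : Fin n → ℝ) i ^ 2 = 1 := by
    rw [Finset.sum_eq_single_of_mem a (Finset.mem_univ a)]
    · simp
    · intro i _ hi; simp [hi]
  rw [hval v, hval (Pi.single a 1), hv, hsingle, Pi.single_eq_same,
    gegenbauer_eq_sum hμ (v a) ℓ (ℓ / 2 + 1) (by omega)]
  have h1 := gegenbauer_eq_sum hμ 1 ℓ (ℓ / 2 + 1) (by omega)
  rw [gegenbauer_one hμ] at h1
  rw [← h1]
  ring

/-! ### Rotations of polynomials and the orthogonal group -/

/-- The substitution `X_i ↦ ∑_j M_{ij} X_j`, i.e. the composition of a polynomial function with the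
linear map given by the matrix `M`. -/
def linSubst {n : ℕ} (M : Matrix (Fin n) (Fin n) ℝ) :
    MvPolynomial (Fin n) ℝ →ₐ[ℝ] MvPolynomial (Fin n) ℝ :=
  MvPolynomial.bind₁ fun i => ∑ j, MvPolynomial.C (M i j) * MvPolynomial.X j

theorem eval_linSubst {n : ℕ} (M : Matrix (Fin n) (Fin n) ℝ) (p : MvPolynomial (Fin n) ℝ)
    (w : Fin n → ℝ) :
    MvPolynomial.eval w (linSubst M p) = MvPolynomial.eval (M.mulVec w) p := by
  induction p using MvPolynomial.induction_on with
  | C a => simp [linSubst]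
  | add p q hp hq => simp [hp, hq]
  | mul_X p i hp =>
    rw [map_mul, map_mul, hp, map_mul]
    simp [linSubst, Matrix.mulVec, dotProduct]

theorem pderiv_linSubst {n : ℕ} (M : Matrix (Fin n) (Fin n) ℝ) (p : MvPolynomial (Fin n) ℝ)
    (k : Fin n) :
    MvPolynomial.pderiv k (linSubst M p) =
      ∑ i, MvPolynomial.C (M i k) * linSubst M (MvPolynomial.pderiv i p) := by
  induction p using MvPolynomial.induction_on with
  | C a => simp [linSubst]
  | add p q hp hq => simp [hp, hq, mul_add, Finset.sum_add_distrib]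
  | mul_X p i hp =>
    have h1 : MvPolynomial.pderiv k (linSubst M (MvPolynomial.X i)) = MvPolynomial.C (M i k) := by
      rw [linSubst, MvPolynomial.bind₁_X_right, map_sum, Finset.sum_eq_single k]
      · simp
      · intro b _ hb
        simp [MvPolynomial.pderiv_X_of_ne hb]
      · simp
    rw [map_mul, MvPolynomial.pderiv_mul, hp, h1]
    simp only [MvPolynomial.pderiv_mul, map_add, map_mul, mul_add, Finset.sum_add_distrib,
      Finset.sum_mul]
    congr 1
    · exact Finset.sum_congr rfl fun _ _ => by ring
    · rw [Finset.sum_eq_single i]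
      · simp; ring
      · intro b _ hb
        simp [MvPolynomial.pderiv_X_of_ne hb.symm]
      · simp

theorem linSubst_mem_harmonicPoly {n ℓ : ℕ} {M : Matrix (Fin n) (Fin n) ℝ}
    (hM : M * M.transpose = 1) {p : MvPolynomial (Fin n) ℝ} (hp : p ∈ harmonicPoly n ℓ) :
    linSubst M p ∈ harmonicPoly n ℓ := by
  obtain ⟨hhom, hΔ⟩ := hp
  rw [SetLike.mem_coe, MvPolynomial.mem_homogeneousSubmodule] at hhom
  rw [SetLike.mem_coe, LinearMap.mem_ker] at hΔ
  refine ⟨?_, ?_⟩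
  · rw [SetLike.mem_coe, MvPolynomial.mem_homogeneousSubmodule]
    have := hhom.aeval (n := 1) (fun i => ∑ j, MvPolynomial.C (M i j) * MvPolynomial.X j)
      fun i => MvPolynomial.IsHomogeneous.sum _ _ _ fun j _ =>
        MvPolynomial.isHomogeneous_C_mul_X _ _
    rwa [one_mul] at this
  · rw [SetLike.mem_coe, LinearMap.mem_ker, polyLaplacian_apply]
    simp only [pderiv_linSubst, map_sum, MvPolynomial.pderiv_C_mul]
    have h : ∀ i i', ∑ k, M i k * M i' k = if i = i' then 1 else 0 := fun i i' => by
      have := congrFun (congrFun hM i) i'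
      rwa [Matrix.mul_apply, Matrix.one_apply] at this
    calc _ = ∑ i, ∑ i', MvPolynomial.C (∑ k, M i k * M i' k) *
        linSubst M (MvPolynomial.pderiv i' (MvPolynomial.pderiv i p)) := by
          rw [Finset.sum_comm]
          refine Finset.sum_congr rfl fun i _ => ?_
          simp only [map_sum, Finset.sum_mul, MvPolynomial.C_mul',
            smul_smul, Finset.mul_sum]
          rw [Finset.sum_comm]
      _ = linSubst M (polyLaplacian n p) := by
          rw [polyLaplacian_apply, map_sum]
          refine Finset.sum_congr rfl fun i _ => ?_
          simp [h]
      _ = 0 := by rw [hΔ, map_zero]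

theorem continuous_coeff_linSubst {n : ℕ} {X : Type*} [TopologicalSpace X]
    {M : X → Matrix (Fin n) (Fin n) ℝ} (hM : ∀ i j, Continuous fun x => M x i j)
    (p : MvPolynomial (Fin n) ℝ) :
    ∀ m, Continuous fun x => MvPolynomial.coeff m (linSubst (M x) p) := by
  induction p using MvPolynomial.induction_on with
  | C a => intro m; simp only [linSubst, MvPolynomial.bind₁_C_right]; exact continuous_const
  | add p q hp hq =>
    intro m
    simp only [map_add, MvPolynomial.coeff_add]
    exact (hp m).add (hq m)
  | mul_X p i hp =>
    classical
    intro m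
    simp only [map_mul, MvPolynomial.coeff_mul]
    refine continuous_finsetSum _ fun d _ => (hp d.1).mul ?_
    simp only [linSubst, MvPolynomial.bind₁_X_right, MvPolynomial.coeff_sum,
      MvPolynomial.coeff_C_mul]
    exact continuous_finsetSum _ fun j _ => (hM i j).mul continuous_const

/-- The orthogonal group `O(n)`, as the group of unitary operators of `ℝⁿ`. -/
abbrev OrthoGroup (n : ℕ) := unitary (EucSp n →L[ℝ] EucSp n)

theorem OrthoGroup.inner_apply {n : ℕ} (g : OrthoGroup n) (x y : EucSp n) :
    inner ℝ (g.1 x) (g.1 y) = inner ℝ x y :=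
  (Unitary.linearIsometryEquiv g).inner_map_map x y

theorem OrthoGroup.norm_apply {n : ℕ} (g : OrthoGroup n) (x : EucSp n) : ‖g.1 x‖ = ‖x‖ :=
  (Unitary.linearIsometryEquiv g).norm_map x

theorem OrthoGroup.mul_apply {n : ℕ} (g h : OrthoGroup n) (x : EucSp n) :
    (g * h).1 x = g.1 (h.1 x) := rfl

/-- Reflections show that `O(n)` acts transitively on spheres, even with `(v - w)^⊥` fixed. -/
theorem OrthoGroup.exists_apply_eq {n : ℕ} {v w : EucSp n} (h : ‖v‖ = ‖w‖) :
    ∃ g : OrthoGroup n, g.1 v = w ∧ ∀ e : EucSp n, inner ℝ (v - w) e = (0 : ℝ) → g.1 e = e := by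
  refine ⟨Unitary.linearIsometryEquiv.symm (Submodule.reflection (Submodule.span ℝ {v - w})ᗮ),
    ?_, ?_⟩
  · exact Submodule.reflection_sub h
  · intro e he
    exact (Submodule.reflection_eq_self_iff _).2
      (Submodule.mem_orthogonal_singleton_iff_inner_right.2 he)

instance (n : ℕ) : ContinuousStar (EucSp n →L[ℝ] EucSp n) :=
  ⟨(ContinuousLinearMap.adjoint (𝕜 := ℝ) (E := EucSp n) (F := EucSp n)).continuous⟩

instance OrthoGroup.instCompactSpace (n : ℕ) : CompactSpace (OrthoGroup n) := by
  have : ProperSpace (EucSp n →L[ℝ] EucSp n) := FiniteDimensional.proper ℝ _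
  apply isCompact_iff_compactSpace.1
  refine Metric.isCompact_of_isClosed_isBounded isClosed_unitary ?_
  refine (Metric.isBounded_closedBall (x := (0 : EucSp n →L[ℝ] EucSp n)) (r := 1)).subset ?_
  intro g hg
  rw [mem_closedBall_zero_iff]
  refine ContinuousLinearMap.opNorm_le_bound _ zero_le_one fun x => ?_
  rw [one_mul]
  exact (OrthoGroup.norm_apply ⟨g, hg⟩ x).le

instance (n : ℕ) : SecondCountableTopology (OrthoGroup n) := by
  have : ProperSpace (EucSp n →L[ℝ] EucSp n) := FiniteDimensional.proper ℝ _
  infer_instance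

/-- The right-invariant probability measure on `O(n)`, as the image of the left Haar measure under
inversion: only right invariance is needed, so unimodularity plays no role. -/
def orthoMeasure (n : ℕ) : Measure (OrthoGroup n) :=
  (Measure.haarMeasure (⊤ : TopologicalSpace.PositiveCompacts (OrthoGroup n))).inv

instance (n : ℕ) : (orthoMeasure n).IsMulRightInvariant := by
  unfold orthoMeasure; infer_instance

instance (n : ℕ) : IsProbabilityMeasure (orthoMeasure n) := by
  constructor
  rw [orthoMeasure, Measure.inv_apply, Set.inv_univ]
  exact Measure.haarMeasure_self

theorem OrthoGroup.continuous_apply (n : ℕ) :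
    Continuous fun q : OrthoGroup n × EucSp n => q.1.1 q.2 := by
  fun_prop

/-- The matrix of an orthogonal map. -/
def orthoMatrix {n : ℕ} (g : OrthoGroup n) : Matrix (Fin n) (Fin n) ℝ :=
  fun i j => g.1 (EuclideanSpace.single j 1) i

theorem orthoMatrix_mulVec {n : ℕ} (g : OrthoGroup n) (w : EucSp n) :
    (orthoMatrix g).mulVec w = g.1 w := by
  have hw : w = ∑ j, w j • EuclideanSpace.single j (1 : ℝ) := by
    ext i; simp [Pi.single_apply]
  ext i
  conv_rhs => rw [hw, map_sum]
  simp [Matrix.mulVec, dotProduct, orthoMatrix, mul_comm]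

theorem orthoMatrix_mul_transpose {n : ℕ} (g : OrthoGroup n) :
    orthoMatrix g * (orthoMatrix g).transpose = 1 := by
  rw [mul_eq_one_comm]
  ext i j
  have := OrthoGroup.inner_apply g (EuclideanSpace.single j 1) (EuclideanSpace.single i 1)
  rw [PiLp.inner_apply, EuclideanSpace.inner_single_left] at this
  simp only [Matrix.mul_apply, Matrix.transpose_apply, orthoMatrix, Matrix.one_apply]
  simpa [Pi.single_apply, eq_comm] using this

/-! ### Averages of spherical harmonics over rotations -/

theorem integrable_of_continuous_ortho {n : ℕ} {F : OrthoGroup n → ℝ} (hF : Continuous F) :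
    Integrable F (orthoMeasure n) :=
  hF.integrable_of_hasCompactSupport (HasCompactSupport.of_compactSpace _)

theorem eq_sum_monomial_of_isHomogeneous {n ℓ : ℕ} {q : MvPolynomial (Fin n) ℝ}
    (hq : q.IsHomogeneous ℓ) :
    q = ∑ m ∈ Finset.univ.finsuppAntidiag ℓ, MvPolynomial.coeff m q • MvPolynomial.monomial m 1 := by
  conv_lhs => rw [q.as_sum]
  rw [Finset.sum_subset (s₂ := Finset.univ.finsuppAntidiag ℓ)]
  · exact Finset.sum_congr rfl fun m _ => by rw [MvPolynomial.smul_monomial, smul_eq_mul, mul_one]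
  · intro m hm
    rw [Finset.mem_finsuppAntidiag]
    refine ⟨?_, Finset.subset_univ _⟩
    have := hq (MvPolynomial.mem_support_iff.1 hm)
    rw [← this, Finsupp.weight_apply, Finsupp.sum_fintype _ _ (by simp)]
    simp
  · intro m _ hm
    rw [MvPolynomial.notMem_support_iff.1 hm, MvPolynomial.monomial_zero]

/-- Averages of the rotations of a harmonic polynomial are harmonic polynomials. -/
theorem exists_averaged_harmonicPoly {n ℓ : ℕ} {p : MvPolynomial (Fin n) ℝ}
    (hp : p ∈ harmonicPoly n ℓ) {F : OrthoGroup n → ℝ} (hF : Continuous F) :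
    ∃ P ∈ harmonicPoly n ℓ, ∀ w : EucSp n, MvPolynomial.eval w P =
      ∫ g, F g * MvPolynomial.eval (g.1 w) p ∂(orthoMeasure n) := by
  have hmem : ∀ g : OrthoGroup n, linSubst (orthoMatrix g) p ∈ harmonicPoly n ℓ := fun g =>
    linSubst_mem_harmonicPoly (orthoMatrix_mul_transpose g) hp
  have hhom : ∀ g : OrthoGroup n, (linSubst (orthoMatrix g) p).IsHomogeneous ℓ := fun g =>
    (MvPolynomial.mem_homogeneousSubmodule _ _).1 (hmem g).1
  have hcont : ∀ m, Continuous fun g : OrthoGroup n =>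
      MvPolynomial.coeff m (linSubst (orthoMatrix g) p) :=
    continuous_coeff_linSubst (fun i j => by unfold orthoMatrix; fun_prop) p
  set P : MvPolynomial (Fin n) ℝ := ∑ m ∈ Finset.univ.finsuppAntidiag ℓ,
    (∫ g, F g * MvPolynomial.coeff m (linSubst (orthoMatrix g) p) ∂(orthoMeasure n)) •
      MvPolynomial.monomial m 1 with hP
  -- Linear functionals of `P` are averages; this applies to the coefficients of the Laplacian and to
  -- evaluation at a point.
  have hΛ : ∀ Λ : MvPolynomial (Fin n) ℝ →ₗ[ℝ] ℝ,
      Λ P = ∫ g, F g * Λ (linSubst (orthoMatrix g) p) ∂(orthoMeasure n) := by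
    intro Λ
    have h1 : ∀ g : OrthoGroup n, F g * Λ (linSubst (orthoMatrix g) p) =
        ∑ m ∈ Finset.univ.finsuppAntidiag ℓ,
          F g * MvPolynomial.coeff m (linSubst (orthoMatrix g) p) *
            Λ (MvPolynomial.monomial m 1) := by
      intro g
      conv_lhs => rw [eq_sum_monomial_of_isHomogeneous (hhom g)]
      rw [map_sum, Finset.mul_sum]
      exact Finset.sum_congr rfl fun m _ => by rw [map_smul, smul_eq_mul, mul_assoc]
    simp_rw [h1]
    have hint : ∀ m, Integrable (fun g => F g *
        MvPolynomial.coeff m (linSubst (orthoMatrix g) p) * Λ (MvPolynomial.monomial m 1))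
        (orthoMeasure n) := fun m =>
      integrable_of_continuous_ortho ((hF.mul (hcont m)).mul continuous_const)
    rw [integral_finsetSum _ fun m _ => hint m, hP, map_sum]
    exact Finset.sum_congr rfl fun m _ => by rw [map_smul, smul_eq_mul, integral_mul_const]
  refine ⟨P, ⟨?_, ?_⟩, fun w => ?_⟩
  · refine Submodule.sum_mem _ fun m hm => Submodule.smul_mem _ _ ?_
    rw [MvPolynomial.mem_homogeneousSubmodule]
    refine MvPolynomial.isHomogeneous_monomial _ ?_
    rw [Finset.mem_finsuppAntidiag] at hm
    rw [← hm.1, Finsupp.degree_eq_sum]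
  · rw [SetLike.mem_coe, LinearMap.mem_ker]
    ext m
    have h2 := hΛ (MvPolynomial.lcoeff ℝ m ∘ₗ polyLaplacian n)
    have h3 : ∀ g : OrthoGroup n, polyLaplacian n (linSubst (orthoMatrix g) p) = 0 := fun g =>
      LinearMap.mem_ker.1 (hmem g).2
    simpa [h3] using h2
  · have h2 := hΛ (MvPolynomial.aeval (R := ℝ) (w : Fin n → ℝ)).toLinearMap
    have hev : ∀ q, MvPolynomial.aeval (R := ℝ) (w : Fin n → ℝ) q = MvPolynomial.eval w q :=
      fun q => RingHom.congr_fun (MvPolynomial.coe_aeval_eq_eval _) q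
    simpa only [AlgHom.toLinearMap_apply, hev, eval_linSubst, orthoMatrix_mulVec] using h2

/-- Averaging a spherical harmonic over the rotations about an axis gives a zonal harmonic, i.e. a
Gegenbauer polynomial. -/
theorem integral_ortho_zonal {n ℓ : ℕ} {a b : Fin n} (hab : a ≠ b) {p : MvPolynomial (Fin n) ℝ}
    (hp : p ∈ harmonicPoly n ℓ) {Φ : EucSp n → ℝ} (hΦ : Continuous Φ) {w : EucSp n}
    (hw : ‖w‖ = 1) :
    ∫ g, Φ (g.1 (EuclideanSpace.single a 1)) * MvPolynomial.eval (g.1 w) p ∂(orthoMeasure n) =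
      gegenbauer (((n : ℝ) - 2) / 2) ℓ (w a) *
        ∫ g, Φ (g.1 (EuclideanSpace.single a 1)) *
          MvPolynomial.eval (g.1 (EuclideanSpace.single a 1)) p ∂(orthoMeasure n) := by
  set e : EucSp n := EuclideanSpace.single a 1 with he
  obtain ⟨P, hP, hPe⟩ := exists_averaged_harmonicPoly hp
    (F := fun g : OrthoGroup n => Φ (g.1 e)) (by fun_prop)
  rw [← hPe, ← hPe]
  have hsq : ∀ x : EucSp n, ‖x‖ ^ 2 = ∑ i, x i ^ 2 := fun x => EuclideanSpace.real_norm_sq_eq x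
  have hinv : ∀ v w : EucSp n, v a = w a → ‖v‖ = ‖w‖ →
      MvPolynomial.eval v P = MvPolynomial.eval w P := by
    intro v w hvw hn
    obtain ⟨h, hvh, hfix⟩ := OrthoGroup.exists_apply_eq hn
    have heh : h.1 e = e := hfix e (by simp [he, EuclideanSpace.inner_single_right, hvw])
    rw [hPe, hPe, ← integral_mul_right_eq_self _ h]
    simp only [OrthoGroup.mul_apply, hvh, heh]
  have := eval_eq_gegenbauer_of_axial hab hP (fun v w h1 h2 => by
    refine hinv (WithLp.toLp 2 v) (WithLp.toLp 2 w) h1 ?_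
    rw [← sq_eq_sq₀ (norm_nonneg _) (norm_nonneg _), hsq, hsq]
    exact h2) (v := w) (by rw [← hsq, hw, one_pow])
  rw [this, he]
  rfl

/-- The rotation taking `x` to `‖x‖ e` reduces the average over a pair `(g x, g e)` to the zonal case;
it takes `e` to a unit vector with axis coordinate `⟨x,e⟩ / ‖x‖`. -/
theorem integral_ortho_pair {n ℓ : ℕ} {a b : Fin n} (hab : a ≠ b) {p : MvPolynomial (Fin n) ℝ}
    (hp : p ∈ harmonicPoly n ℓ) {f : EucSp n → ℝ} (hf : Continuous f) {x : EucSp n}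
    (hx : x ≠ 0) :
    ∫ g, f (g.1 x) * MvPolynomial.eval (g.1 (EuclideanSpace.single a 1)) p ∂(orthoMeasure n) =
      gegenbauer (((n : ℝ) - 2) / 2) ℓ (x a / ‖x‖) *
        ∫ g, f (‖x‖ • g.1 (EuclideanSpace.single a 1)) *
          MvPolynomial.eval (g.1 (EuclideanSpace.single a 1)) p ∂(orthoMeasure n) := by
  set e : EucSp n := EuclideanSpace.single a 1 with he
  have hx' : ‖x‖ ≠ 0 := norm_ne_zero_iff.2 hx
  have hen : ‖e‖ = 1 := by simp [he]
  obtain ⟨h, hh, -⟩ := OrthoGroup.exists_apply_eq (v := x) (w := ‖x‖ • e)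
    (by rw [norm_smul, hen, norm_norm, mul_one])
  have hcoord : (h.1 e) a = x a / ‖x‖ := by
    have h1 := OrthoGroup.inner_apply h e x
    rw [hh, inner_smul_right, he, EuclideanSpace.inner_single_right,
      EuclideanSpace.inner_single_left, ← he] at h1
    rw [eq_div_iff hx']
    simpa [mul_comm] using h1
  have hz := integral_ortho_zonal hab hp (Φ := fun y => f (‖x‖ • y)) (by fun_prop) (w := h.1 e)
    (by rw [OrthoGroup.norm_apply, hen])
  rw [hcoord] at hz
  rw [← hz, ← integral_mul_right_eq_self _ h]
  simp only [OrthoGroup.mul_apply, hh, map_smul, he]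

/-! ### The surface measure of the sphere as an invariant measure -/

/-- The action of an orthogonal map on the unit sphere. -/
def sphereRotation {n : ℕ} (g : OrthoGroup n) (θ : UnitSphere n) : UnitSphere n :=
  ⟨g.1 θ, by rw [mem_sphere_zero_iff_norm, OrthoGroup.norm_apply]; exact norm_eq_of_mem_sphere θ⟩

theorem continuous_sphereRotation (n : ℕ) :
    Continuous fun q : OrthoGroup n × UnitSphere n => sphereRotation q.1 q.2 := by
  unfold sphereRotation
  fun_prop

open scoped Pointwise in
theorem measurePreserving_sphereRotation {n : ℕ} (g : OrthoGroup n) :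
    MeasurePreserving (sphereRotation g) (sphereMeasure n) (sphereMeasure n) := by
  have hc : Continuous (sphereRotation g) :=
    (continuous_sphereRotation n).comp (Continuous.prodMk_right g)
  refine ⟨hc.measurable, ?_⟩
  ext s hs
  rw [Measure.map_apply hc.measurable hs, sphereMeasure, Measure.toSphere_apply' _ hs,
    Measure.toSphere_apply' _ (hc.measurable hs)]
  congr 1
  rw [← (Unitary.linearIsometryEquiv g).measurePreserving.measure_preimage_emb
    (Unitary.linearIsometryEquiv g).toHomeomorph.measurableEmbedding (Ioo (0 : ℝ) 1 • (_ '' s))]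
  congr 1
  ext x
  simp only [Set.mem_smul, Set.mem_preimage, Set.mem_image]
  constructor
  · rintro ⟨r, hr, _, ⟨θ, hθ, rfl⟩, rfl⟩
    exact ⟨r, hr, _, ⟨_, hθ, rfl⟩, (map_smul (Unitary.linearIsometryEquiv g) r (θ : EucSp n)).symm⟩
  · rintro ⟨r, hr, _, ⟨θ, hθ, rfl⟩, hx⟩
    have hinv : g.1 (g⁻¹.1 θ) = θ := by
      rw [← OrthoGroup.mul_apply, mul_inv_cancel]; rfl
    refine ⟨r, hr, _, ⟨sphereRotation g⁻¹ θ, ?_, rfl⟩, ?_⟩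
    · have : sphereRotation g (sphereRotation g⁻¹ θ) = θ := Subtype.ext hinv
      rwa [this]
    · apply (Unitary.linearIsometryEquiv g).injective
      rw [← hx, map_smul]
      exact congrArg (r • ·) hinv

/-- The surface measure of the sphere is the image of the invariant measure of `O(n)`, up to
normalization. -/
theorem integral_sphere_eq_integral_ortho {n : ℕ} (z : UnitSphere n) {Φ : UnitSphere n → ℝ}
    (hΦ : Continuous Φ) :
    ∫ θ, Φ θ ∂(sphereMeasure n) =
      sphereArea n * ∫ g, Φ (sphereRotation g z) ∂(orthoMeasure n) := by
  have hfin : IsFiniteMeasure (sphereMeasure n) := by unfold sphereMeasure; infer_instance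
  have hc := continuous_sphereRotation n
  have hinv : ∀ g : OrthoGroup n, ∫ θ, Φ (sphereRotation g θ) ∂(sphereMeasure n) =
      ∫ θ, Φ θ ∂(sphereMeasure n) := by
    intro g
    have hcg : Continuous (sphereRotation g) := hc.comp (Continuous.prodMk_right g)
    rw [← integral_map hcg.measurable.aemeasurable hΦ.aestronglyMeasurable,
      (measurePreserving_sphereRotation g).map_eq]
  have hconst : ∀ θ : UnitSphere n, ∫ g, Φ (sphereRotation g θ) ∂(orthoMeasure n) =
      ∫ g, Φ (sphereRotation g z) ∂(orthoMeasure n) := by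
    intro θ
    obtain ⟨h, hh, -⟩ := OrthoGroup.exists_apply_eq (v := (z : EucSp n)) (w := θ)
      (by rw [norm_eq_of_mem_sphere, norm_eq_of_mem_sphere])
    rw [← integral_mul_right_eq_self (fun g => Φ (sphereRotation g z)) h]
    refine integral_congr_ae (Eventually.of_forall fun g => ?_)
    have : sphereRotation (g * h) z = sphereRotation g θ :=
      Subtype.ext (by change g.1 (h.1 z) = g.1 θ; rw [hh])
    simp only [this]
  calc ∫ θ, Φ θ ∂(sphereMeasure n)
      = ∫ g, ∫ θ, Φ (sphereRotation g θ) ∂(sphereMeasure n) ∂(orthoMeasure n) := by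
        simp [hinv]
    _ = ∫ θ, ∫ g, Φ (sphereRotation g θ) ∂(orthoMeasure n) ∂(sphereMeasure n) :=
        integral_integral_swap_of_hasCompactSupport
          (f := fun (g : OrthoGroup n) (θ : UnitSphere n) => Φ (sphereRotation g θ)) (hΦ.comp hc)
          (HasCompactSupport.of_compactSpace _)
    _ = _ := by simp [hconst, sphereArea]

/-- A function on the sphere is continuous if its lift to `O(n)` is, because the orbit map of the
compact group is a quotient map. -/
theorem continuous_of_continuous_lift {n : ℕ} (z : UnitSphere n) {Φ : UnitSphere n → ℝ}
    (h : Continuous fun g : OrthoGroup n => Φ (sphereRotation g z)) : Continuous Φ := by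
  have hc : Continuous fun g : OrthoGroup n => sphereRotation g z :=
    (continuous_sphereRotation n).comp (Continuous.prodMk_left z)
  have hs : Function.Surjective fun g : OrthoGroup n => sphereRotation g z := by
    intro θ
    obtain ⟨h, hh, -⟩ := OrthoGroup.exists_apply_eq (v := (z : EucSp n)) (w := θ)
      (by rw [norm_eq_of_mem_sphere, norm_eq_of_mem_sphere])
    exact ⟨h, Subtype.ext hh⟩
  exact ((hc.isClosedMap.isQuotientMap hc hs).continuous_iff).2 h

/-! ### The conical Radon transform in graph coordinates -/

theorem finrank_orthHyperplane {n : ℕ} (hn : 2 ≤ n) {z : EucSp n} (hz : ‖z‖ = 1) :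
    Module.finrank ℝ (orthHyperplane z) = n - 1 := by
  have h2 := (Submodule.span ℝ {z}).finrank_add_finrank_orthogonal
  rw [finrank_span_singleton (by rintro rfl; simp at hz), finrank_euclideanSpace_fin] at h2
  change Module.finrank ℝ ((Submodule.span ℝ {z})ᗮ : Submodule ℝ (EucSp n)) = _
  omega

theorem norm_fderiv_const_sub_norm_mul {E : Type*} [NormedAddCommGroup E] [InnerProductSpace ℝ E]
    [Nontrivial E] (a c : ℝ) {y : E} (hy : y ≠ 0) :
    ‖fderiv ℝ (fun y : E => a - ‖y‖ * c) y‖ = |c| := by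
  have hd : DifferentiableAt ℝ (fun y : E => ‖y‖) y :=
    (contDiffAt_norm ℝ hy).differentiableAt one_ne_zero
  rw [fderiv_const_sub, fderiv_mul_const hd, norm_neg, norm_smul, norm_fderiv_norm hd, mul_one,
    Real.norm_eq_abs]

theorem measurable_surfaceDensity {E : Type*} [NormedAddCommGroup E] [NormedSpace ℝ E]
    [MeasurableSpace E] [OpensMeasurableSpace E] (h : E → ℝ) :
    Measurable fun y : E => ENNReal.ofReal (Real.sqrt (1 + ‖fderiv ℝ h y‖ ^ 2)) :=
  (((measurable_fderiv ℝ h).norm.pow_const 2).const_add 1).sqrt.ennreal_ofReal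

theorem inner_orthHyperplane {n : ℕ} {z : EucSp n} (y : orthHyperplane z) :
    inner ℝ (y : EucSp n) z = (0 : ℝ) :=
  (Submodule.mem_orthogonal' _ _).1 y.2 z (Submodule.mem_span_singleton_self z)

/-- The orthogonal projection is a continuous left inverse of the graph map. -/
theorem measurableEmbedding_graphPoint {n : ℕ} {z : EucSp n} {h : orthHyperplane z → ℝ}
    (hh : Continuous h) : MeasurableEmbedding (graphPoint z h) := by
  have hinv : Function.LeftInverse (orthHyperplane z).orthogonalProjectionOnto (graphPoint z h) := by
    intro y
    rw [graphPoint, map_add, map_smul, Submodule.orthogonalProjectionOnto_mem_subspace_eq_self,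
      Submodule.orthogonalProjectionOnto_eq_zero_iff.2, smul_zero, add_zero]
    exact Submodule.le_orthogonal_orthogonal _ (Submodule.mem_span_singleton_self z)
  exact (hinv.isClosedEmbedding (by fun_prop) (by unfold graphPoint; fun_prop)).measurableEmbedding

/-- In graph coordinates the surface element is `dy / sin ψ` and the distance to the vertex is
`‖y‖ / sin ψ`. -/
theorem conicalRadon_eq_integral {n : ℕ} (hn : 2 ≤ n) (U : ℝ → ℝ) (f : EucSp n → ℝ) {z : EucSp n}
    (hz : ‖z‖ = 1) {ψ : ℝ} (h0 : 0 < ψ) (h1 : ψ ≤ Real.pi / 2) :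
    conicalRadon U f z ψ = ∫ y : orthHyperplane z,
      (Real.sin ψ)⁻¹ * (f (y + (1 - ‖y‖ * Real.cot ψ) • z) * U (‖y‖ / Real.sin ψ)) := by
  have hs : 0 < Real.sin ψ := Real.sin_pos_of_pos_of_lt_pi h0 (by linarith [Real.pi_pos])
  have : Nontrivial (orthHyperplane z) :=
    Module.nontrivial_of_finrank_pos (R := ℝ) (by rw [finrank_orthHyperplane hn hz]; omega)
  have hcont : Continuous (coneHeight z ψ) := by unfold coneHeight; fun_prop
  have hemb := measurableEmbedding_graphPoint hcont
  rw [conicalRadon, coneSurface_eq_range hn hz h0 h1, graphSurfaceMeasure, hemb.setIntegral_map,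
    Set.preimage_range, setIntegral_univ, integral_withDensity_eq_integral_toReal_smul
      (measurable_surfaceDensity _) (by simp)]
  have hae : ∀ᵐ y : orthHyperplane z, y ≠ 0 := by
    rw [ae_iff]; simp
  refine integral_congr_ae (hae.mono fun y hy => ?_)
  have hsq : Real.sqrt (1 + |Real.cot ψ| ^ 2) = (Real.sin ψ)⁻¹ := by
    rw [sq_abs, Real.cot_eq_cos_div_sin, Real.sqrt_eq_iff_mul_self_eq (by positivity) (by positivity)]
    field_simp
    linarith [Real.sin_sq_add_cos_sq ψ]
  have hdist : ‖graphPoint z (coneHeight z ψ) y - z‖ = ‖y‖ / Real.sin ψ := by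
    have e1 : graphPoint z (coneHeight z ψ) y - z =
        (y : EucSp n) - (‖y‖ * Real.cot ψ) • z := by
      rw [graphPoint, coneHeight]; module
    rw [← sq_eq_sq₀ (norm_nonneg _) (by positivity), e1, norm_sub_sq_real, norm_smul,
      inner_smul_right, inner_orthHyperplane, hz, Real.norm_eq_abs, mul_one, sq_abs,
      Real.cot_eq_cos_div_sin, Submodule.coe_norm]
    field_simp
    linear_combination ‖(y : EucSp n)‖ ^ 2 * Real.sin_sq_add_cos_sq ψ
  have hder : ‖fderiv ℝ (coneHeight z ψ) y‖ = |Real.cot ψ| :=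
    norm_fderiv_const_sub_norm_mul 1 (Real.cot ψ) hy
  simp only [hder, hsq, hdist, smul_eq_mul]
  rw [ENNReal.toReal_ofReal (by positivity)]
  rfl

/-! ### Radial form of the coefficients of the transform -/

/-- The isometry between the hyperplanes orthogonal to `z` and to `g z` given by `g`. -/
def orthHyperplaneIsometry {n : ℕ} (g : OrthoGroup n) (z : EucSp n) :
    orthHyperplane z ≃ₗᵢ[ℝ] orthHyperplane (g.1 z) where
  toLinearEquiv := (Unitary.linearIsometryEquiv g).toLinearEquiv.ofSubmodules _ _ (by
    have := Submodule.map_orthogonal_equiv (Submodule.span ℝ {z}) (Unitary.linearIsometryEquiv g)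
    rw [Submodule.map_span, Set.image_singleton] at this
    exact this)
  norm_map' y := OrthoGroup.norm_apply g y

/-- All cones are rotated copies of one cone; the integral stays over the fixed hyperplane `z^⊥`. -/
theorem conicalRadon_rotate {n : ℕ} (hn : 2 ≤ n) (U : ℝ → ℝ) (f : EucSp n → ℝ) (g : OrthoGroup n)
    {z : EucSp n} (hz : ‖z‖ = 1) {ψ : ℝ} (h0 : 0 < ψ) (h1 : ψ ≤ Real.pi / 2) :
    conicalRadon U f (g.1 z) ψ = ∫ y : orthHyperplane z,
      (Real.sin ψ)⁻¹ * (f (g.1 (y + (1 - ‖y‖ * Real.cot ψ) • z)) * U (‖y‖ / Real.sin ψ)) := by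
  rw [conicalRadon_eq_integral hn U f (by rw [OrthoGroup.norm_apply, hz]) h0 h1,
    ← (orthHyperplaneIsometry g z).measurePreserving.integral_comp
      (orthHyperplaneIsometry g z).toHomeomorph.measurableEmbedding]
  simp only [LinearIsometryEquiv.norm_map, map_add, map_smul]
  rfl

theorem norm_sq_conePoint {n : ℕ} {z : EucSp n} (hz : ‖z‖ = 1) (y : orthHyperplane z) (c : ℝ) :
    ‖(y : EucSp n) + c • z‖ ^ 2 = ‖y‖ ^ 2 + c ^ 2 := by
  rw [norm_add_sq_real, inner_smul_right, inner_orthHyperplane, norm_smul, hz, Real.norm_eq_abs,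
    mul_one, sq_abs, mul_zero, mul_zero, add_zero]
  rfl

/-- The coefficient of the conical Radon transform, as an integral over a hyperplane of a radial
function. -/
theorem radonCoeff_eq_integral_hyperplane {n ℓ : ℕ} {a b : Fin n} (hab : a ≠ b)
    {p : MvPolynomial (Fin n) ℝ} (hp : p ∈ harmonicPoly n ℓ) {Y : UnitSphere n → ℝ}
    (hY : ∀ θ : UnitSphere n, Y θ = MvPolynomial.eval (θ : EucSp n) p)
    {U : ℝ → ℝ} (hU : Continuous U) {f : EucSp n → ℝ} (hf : Continuous f)
    (hfb : ∀ x, 1 ≤ ‖x‖ → f x = 0) {ψ : ℝ} (h0 : 0 < ψ) (h1 : ψ ≤ Real.pi / 2) :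
    radonCoeff Y U f ψ = ∫ y : orthHyperplane (EuclideanSpace.single a 1 : EucSp n),
      (Real.sin ψ)⁻¹ * (U (‖y‖ / Real.sin ψ) *
        (gegenbauer (((n : ℝ) - 2) / 2) ℓ ((1 - ‖y‖ * Real.cot ψ) /
          √(‖y‖ ^ 2 + (1 - ‖y‖ * Real.cot ψ) ^ 2)) *
        radialCoeff Y f √(‖y‖ ^ 2 + (1 - ‖y‖ * Real.cot ψ) ^ 2))) := by
  have hn : 2 ≤ n := by
    by_contra h
    have := a.2; have := b.2
    exact hab (Fin.ext (by omega))
  set e : EucSp n := EuclideanSpace.single a 1 with he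
  have hen : ‖e‖ = 1 := by simp [he]
  have hs : 0 < Real.sin ψ := Real.sin_pos_of_pos_of_lt_pi h0 (by linarith [Real.pi_pos])
  set z : UnitSphere n := ⟨e, by rw [mem_sphere_zero_iff_norm, hen]⟩ with hz
  have hpc : Continuous fun x : EucSp n => MvPolynomial.eval x p :=
    (MvPolynomial.continuous_eval p).comp (by fun_prop)
  set G : OrthoGroup n → orthHyperplane e → ℝ := fun g y =>
    (Real.sin ψ)⁻¹ * (f (g.1 (y + (1 - ‖y‖ * Real.cot ψ) • e)) * U (‖y‖ / Real.sin ψ)) with hG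
  have hGc : Continuous (Function.uncurry G) := by
    have hx : Continuous fun q : OrthoGroup n × orthHyperplane e =>
        (q.2 : EucSp n) + (1 - ‖q.2‖ * Real.cot ψ) • e :=
      (continuous_subtype_val.comp continuous_snd).add
        ((continuous_const.sub (continuous_snd.norm.mul continuous_const)).smul continuous_const)
    have hgx := (OrthoGroup.continuous_apply n).comp (continuous_fst.prodMk hx)
    exact continuous_const.mul ((hf.comp hgx).mul
      (hU.comp (continuous_snd.norm.div_const _)))
  have hGs : ∀ g y, y ∉ Metric.closedBall (0 : orthHyperplane e) 1 → G g y = 0 := by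
    intro g y hy
    rw [mem_closedBall_zero_iff, not_le] at hy
    have : f (g.1 (y + (1 - ‖y‖ * Real.cot ψ) • e)) = 0 := by
      apply hfb
      rw [OrthoGroup.norm_apply, ← one_le_sq_iff₀ (norm_nonneg _), norm_sq_conePoint hen]
      nlinarith [sq_nonneg (1 - ‖y‖ * Real.cot ψ)]
    simp only [hG, this, zero_mul, mul_zero]
  have hRG : ∀ g : OrthoGroup n, conicalRadon U f (sphereRotation g z : EucSp n) ψ = ∫ y, G g y :=
    fun g => conicalRadon_rotate hn U f g hen h0 h1
  have hRc : Continuous fun θ : UnitSphere n => conicalRadon U f (θ : EucSp n) ψ := by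
    apply continuous_of_continuous_lift z
    simp only [hRG]
    rw [← continuousOn_univ]
    exact continuousOn_integral_of_compact_support (isCompact_closedBall 0 1) hGc.continuousOn
      fun g y _ hy => hGs g y hy
  have hYc : Continuous Y := by
    rw [show Y = fun θ : UnitSphere n => MvPolynomial.eval (θ : EucSp n) p from funext hY]
    exact hpc.comp continuous_subtype_val
  have hYg : ∀ g : OrthoGroup n, Y (sphereRotation g z) = MvPolynomial.eval (g.1 e) p :=
    fun g => hY _
  rw [radonCoeff, sphCoeff, integral_sphere_eq_integral_ortho z
    (Φ := fun θ => conicalRadon U f (θ : EucSp n) ψ * Y θ) (hRc.mul hYc)]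
  simp only [hRG, hYg, ← integral_mul_const]
  rw [integral_integral_swap_of_hasCompactSupport
    (f := fun (g : OrthoGroup n) y => G g y * MvPolynomial.eval (g.1 e) p)]
  rotate_left
  · refine hGc.mul (hpc.comp (g := fun x : EucSp n => MvPolynomial.eval x p)
      (f := fun q : OrthoGroup n × orthHyperplane e => q.1.1 e) (by fun_prop))
  · refine HasCompactSupport.intro (isCompact_univ.prod (isCompact_closedBall 0 1))
      fun q hq => ?_
    have : q.2 ∉ Metric.closedBall (0 : orthHyperplane e) 1 := fun h => hq ⟨mem_univ _, h⟩
    simp [Function.uncurry, hGs q.1 q.2 this]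
  rw [← integral_const_mul]
  refine integral_congr_ae (Eventually.of_forall fun y => ?_)
  set x : EucSp n := y + (1 - ‖y‖ * Real.cot ψ) • e with hx
  have hxn2 : ‖x‖ ^ 2 = ‖y‖ ^ 2 + (1 - ‖y‖ * Real.cot ψ) ^ 2 := norm_sq_conePoint hen y _
  have hxn : √(‖y‖ ^ 2 + (1 - ‖y‖ * Real.cot ψ) ^ 2) = ‖x‖ := by
    rw [← hxn2, Real.sqrt_sq (norm_nonneg _)]
  -- The cone `S(z,ψ)` does not pass through the origin as `ψ ≠ 0`.
  have hx0 : x ≠ 0 := by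
    intro h
    rw [h, norm_zero] at hxn2
    have hy : ‖y‖ = 0 := by nlinarith [sq_nonneg (1 - ‖y‖ * Real.cot ψ), sq_nonneg ‖y‖]
    rw [hy] at hxn2
    norm_num at hxn2
  have hxa : x a = 1 - ‖y‖ * Real.cot ψ := by
    have hea : ∀ v : EucSp n, inner ℝ v e = (0 : ℝ) → v a = 0 := by
      intro v hv
      rw [he, EuclideanSpace.inner_single_right] at hv
      simpa using hv
    have hya : (y : EucSp n) a = 0 := hea y (inner_orthHyperplane y)
    have hxa : x a = (y : EucSp n) a + (1 - ‖y‖ * Real.cot ψ) * e a := rfl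
    rw [hxa, hya, show e a = 1 by simp [he]]
    ring
  have hrad : radialCoeff Y f ‖x‖ = sphereArea n * ∫ g, f (‖x‖ • g.1 e) *
      MvPolynomial.eval (g.1 e) p ∂(orthoMeasure n) := by
    rw [radialCoeff, sphCoeff, integral_sphere_eq_integral_ortho z (by fun_prop)]
    simp only [hYg]
    rfl
  have hpair := integral_ortho_pair hab hp hf hx0
  have h3 : ∀ g : OrthoGroup n, G g y * MvPolynomial.eval (g.1 e) p =
      ((Real.sin ψ)⁻¹ * U (‖y‖ / Real.sin ψ)) * (f (g.1 x) * MvPolynomial.eval (g.1 e) p) :=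
    fun g => by simp only [hG, hx]; ring
  simp only [h3, integral_const_mul, hxn, hrad]
  rw [hpair, hxa]
  ring

theorem sphereArea_pred {n : ℕ} (hn : 2 ≤ n) {z : EucSp n} (hz : ‖z‖ = 1) :
    sphereArea (n - 1) = (n - 1 : ℕ) *
      (volume : Measure (orthHyperplane z)).real (Metric.ball 0 1) := by
  have hfr := finrank_orthHyperplane hn hz
  have : Nontrivial (orthHyperplane z) :=
    Module.nontrivial_of_finrank_pos (R := ℝ) (by rw [hfr]; omega)
  have : Nontrivial (EucSp (n - 1)) :=
    Module.nontrivial_of_finrank_pos (R := ℝ) (by rw [finrank_euclideanSpace_fin]; omega)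
  rw [sphereArea, sphereMeasure, Measure.toSphere_real_apply_univ, finrank_euclideanSpace_fin,
    Measure.real, Measure.real, InnerProductSpace.volume_ball, InnerProductSpace.volume_ball, hfr,
    finrank_euclideanSpace_fin]

/-- The coefficient of the conical Radon transform, as an integral over the distance `r` to the
vertex of the cone. -/
theorem radonCoeff_eq_integral_radial {n ℓ : ℕ} (hn : 2 ≤ n) {Y : UnitSphere n → ℝ}
    (hY : IsSphericalHarmonic n ℓ Y)
    {U : ℝ → ℝ} (hU : Continuous U) {f : EucSp n → ℝ} (hf : Continuous f)
    (hfb : ∀ x, 1 ≤ ‖x‖ → f x = 0) {ψ : ℝ} (h0 : 0 < ψ) (h1 : ψ ≤ Real.pi / 2) :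
    radonCoeff Y U f ψ = sphereArea (n - 1) * Real.sin ψ ^ (n - 2) *
      ∫ r in Ioi (0 : ℝ), r ^ (n - 2) * (U r *
        (gegenbauer (((n : ℝ) - 2) / 2) ℓ ((1 - r * Real.cos ψ) /
          √(1 - 2 * r * Real.cos ψ + r ^ 2)) *
        radialCoeff Y f √(1 - 2 * r * Real.cos ψ + r ^ 2))) := by
  obtain ⟨p, hp, hYp⟩ := hY
  set a : Fin n := ⟨0, by omega⟩
  set b : Fin n := ⟨1, by omega⟩
  have hab : a ≠ b := by simp [a, b]
  have hs : 0 < Real.sin ψ := Real.sin_pos_of_pos_of_lt_pi h0 (by linarith [Real.pi_pos])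
  have hen : ‖(EuclideanSpace.single a 1 : EucSp n)‖ = 1 := by simp
  rw [radonCoeff_eq_integral_hyperplane hab hp hYp hU hf hfb h0 h1]
  have hfr := finrank_orthHyperplane hn hen
  have : Nontrivial (orthHyperplane (EuclideanSpace.single a 1 : EucSp n)) :=
    Module.nontrivial_of_finrank_pos (R := ℝ) (by rw [hfr]; omega)
  rw [integral_fun_norm_addHaar (volume : Measure (orthHyperplane _)) (fun s =>
    (Real.sin ψ)⁻¹ * (U (s / Real.sin ψ) *
        (gegenbauer (((n : ℝ) - 2) / 2) ℓ ((1 - s * Real.cot ψ) /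
          √(s ^ 2 + (1 - s * Real.cot ψ) ^ 2)) *
        radialCoeff Y f √(s ^ 2 + (1 - s * Real.cot ψ) ^ 2)))), hfr, sphereArea_pred hn hen,
    nsmul_eq_mul, smul_eq_mul, ← mul_assoc, mul_assoc _ (Real.sin ψ ^ (n - 2))]
  congr 1
  have hsub := integral_comp_mul_left_Ioi' (fun s => s ^ (n - 1 - 1) • ((Real.sin ψ)⁻¹ *
    (U (s / Real.sin ψ) * (gegenbauer (((n : ℝ) - 2) / 2) ℓ ((1 - s * Real.cot ψ) /
      √(s ^ 2 + (1 - s * Real.cot ψ) ^ 2)) *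
        radialCoeff Y f √(s ^ 2 + (1 - s * Real.cot ψ) ^ 2))))) 0 hs
  rw [mul_zero] at hsub
  rw [← hsub, ← integral_smul, ← integral_const_mul]
  refine setIntegral_congr_fun measurableSet_Ioi fun r _ => ?_
  have e1 : Real.sin ψ * r * Real.cot ψ = r * Real.cos ψ := by
    rw [Real.cot_eq_cos_div_sin]; field_simp
  have e2 : (Real.sin ψ * r) ^ 2 + (1 - r * Real.cos ψ) ^ 2 =
      1 - 2 * r * Real.cos ψ + r ^ 2 := by
    linear_combination r ^ 2 * Real.sin_sq_add_cos_sq ψ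
  simp only [e1, e2, mul_div_cancel_left₀ r hs.ne', smul_eq_mul,
    show n - 1 - 1 = n - 2 by omega]
  rw [mul_pow (Real.sin ψ) r (n - 2)]
  field_simp

/-! ### The integral in the variable `v = √(t-s)` -/

theorem gegenbauer_neg (μ x : ℝ) : ∀ ℓ : ℕ, gegenbauer μ ℓ (-x) = (-1) ^ ℓ * gegenbauer μ ℓ x
  | 0 => by simp [gegenbauer]
  | 1 => by simp [gegenbauer]
  | ℓ + 2 => by
    rw [gegenbauer, gegenbauer, gegenbauer_neg μ x ℓ, gegenbauer_neg μ x (ℓ + 1)]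
    ring

theorem continuous_gegenbauer (μ : ℝ) : ∀ ℓ : ℕ, Continuous (gegenbauer μ ℓ)
  | 0 => continuous_const
  | 1 => continuous_id
  | ℓ + 2 => by
    have h0 := continuous_gegenbauer μ ℓ
    have h1 := continuous_gegenbauer μ (ℓ + 1)
    simp only [funext (fun x => gegenbauer.eq_3 μ x ℓ)]
    fun_prop

/-- The integrand of the transformed Abel equation in the variable `v = √(t-s)`, for a radial
coefficient `R`. -/
def abelIntegrand (n : ℕ) (U R : ℝ → ℝ) (ℓ : ℕ) (t v : ℝ) : ℝ :=
  R √(1 - t + v ^ 2) * ∑ σ ∈ ({1, -1} : Finset ℝ), σ ^ ℓ * U (√t - σ * v) *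
    (√t - σ * v) ^ (n - 2) *
      gegenbauer (((n : ℝ) - 2) / 2) ℓ ((√t * v + σ * (1 - t)) / √(1 - t + v ^ 2))

/-- The integrand over the distance `r` to the vertex of the cone. -/
def vertexIntegrand (n : ℕ) (U R : ℝ → ℝ) (ℓ : ℕ) (t r : ℝ) : ℝ :=
  r ^ (n - 2) * (U r * (gegenbauer (((n : ℝ) - 2) / 2) ℓ ((1 - r * √t) /
    √(1 - 2 * r * √t + r ^ 2)) * R √(1 - 2 * r * √t + r ^ 2)))

/-- The two points of the cone at the distances `√t ∓ v` from the vertex have the same norm; the sign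
`σ^ℓ` comes from the parity of the Gegenbauer polynomial. -/
theorem abelIntegrand_eq_add {n ℓ : ℕ} {U R : ℝ → ℝ} {t : ℝ} (ht : 0 ≤ t) (v : ℝ) :
    abelIntegrand n U R ℓ t v =
      vertexIntegrand n U R ℓ t (√t - v) + vertexIntegrand n U R ℓ t (√t + v) := by
  have hsq := Real.sq_sqrt ht
  have e1 : 1 - 2 * (√t - v) * √t + (√t - v) ^ 2 = 1 - t + v ^ 2 := by linear_combination -hsq
  have e2 : 1 - 2 * (√t + v) * √t + (√t + v) ^ 2 = 1 - t + v ^ 2 := by linear_combination -hsq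
  have e3 : 1 - (√t - v) * √t = √t * v + 1 * (1 - t) := by linear_combination -hsq
  have e4 : 1 - (√t + v) * √t = -(√t * v + -1 * (1 - t)) := by linear_combination -hsq
  rw [abelIntegrand, vertexIntegrand, vertexIntegrand, Finset.sum_pair (by norm_num), e1, e2, e3,
    e4, neg_div, gegenbauer_neg]
  rw [one_mul v, show √t - -1 * v = √t + v by ring, one_pow]
  ring

theorem continuous_vertexIntegrand {n ℓ : ℕ} {U R : ℝ → ℝ} (hU : Continuous U) (hR : Continuous R)
    {t : ℝ} (ht : 0 ≤ t) (ht1 : t < 1) : Continuous (vertexIntegrand n U R ℓ t) := by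
  have hC := continuous_gegenbauer (((n : ℝ) - 2) / 2) ℓ
  have hpos : ∀ r, √(1 - 2 * r * √t + r ^ 2) ≠ 0 := by
    intro r
    apply ne_of_gt
    apply Real.sqrt_pos.2
    nlinarith [Real.sq_sqrt ht, sq_nonneg (r - √t)]
  unfold vertexIntegrand
  fun_prop (disch := exact hpos _)

theorem integral_vertexIntegrand {n ℓ : ℕ} {U R : ℝ → ℝ} (hU : Continuous U) (hR : Continuous R)
    (hR1 : ∀ ρ, 1 ≤ ρ → R ρ = 0) {t : ℝ} (ht : 0 ≤ t) (ht1 : t < 1) :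
    ∫ r in Ioi (0 : ℝ), vertexIntegrand n U R ℓ t r =
      ∫ v in Ioo 0 √t, abelIntegrand n U R ℓ t v := by
  have hc := continuous_vertexIntegrand (n := n) (ℓ := ℓ) hU hR ht ht1
  have h0 := Real.sqrt_nonneg t
  have h1 : ∫ r in Ioi (0 : ℝ), vertexIntegrand n U R ℓ t r =
      ∫ r in (0 : ℝ)..(√t + √t), vertexIntegrand n U R ℓ t r := by
    rw [intervalIntegral.integral_of_le (by positivity)]
    -- For `r > 2√t` the point of the cone lies outside the unit ball, where `R` vanishes.
    apply setIntegral_eq_of_subset_of_forall_sdiff_eq_zero measurableSet_Ioi Ioc_subset_Ioi_self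
    intro r hr
    have hr2 : √t + √t < r := by
      by_contra h
      exact hr.2 ⟨hr.1, not_lt.1 h⟩
    rw [vertexIntegrand, hR1]
    · ring
    · rw [Real.one_le_sqrt]; nlinarith
  rw [h1, ← integral_Ioc_eq_integral_Ioo, ← intervalIntegral.integral_of_le h0]
  simp only [abelIntegrand_eq_add ht]
  rw [intervalIntegral.integral_add (by apply Continuous.intervalIntegrable; fun_prop)
    (by apply Continuous.intervalIntegrable; fun_prop), intervalIntegral.integral_comp_sub_left,
    intervalIntegral.integral_comp_add_left, sub_self, sub_zero, add_zero,
    intervalIntegral.integral_add_adjacent_intervals (hc.intervalIntegrable _ _)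
      (hc.intervalIntegrable _ _)]

/-- The bound is uniform up to `t = 1`: by Cauchy-Schwarz the argument of the Gegenbauer polynomial
lies in `[-1,1]`. At `t = 1`, `v = 0` that argument is the undefined quotient `0/0`, so the integrand
need not be continuous there. -/
theorem exists_abelIntegrand_bound {n ℓ : ℕ} {U R : ℝ → ℝ} (hU : Continuous U)
    (hR : Continuous R) : ∃ M, ∀ t ∈ Icc (0 : ℝ) 1, ∀ v ∈ Ioo 0 √t,
      ‖abelIntegrand n U R ℓ t v‖ ≤ M := by
  have hC := continuous_gegenbauer (((n : ℝ) - 2) / 2) ℓ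
  obtain ⟨MU, hMU⟩ := isCompact_Icc.exists_bound_of_continuousOn (s := Icc (0 : ℝ) 2)
    hU.continuousOn
  obtain ⟨MR, hMR⟩ := isCompact_Icc.exists_bound_of_continuousOn (s := Icc (0 : ℝ) 1)
    hR.continuousOn
  obtain ⟨MC, hMC⟩ := isCompact_Icc.exists_bound_of_continuousOn (s := Icc (-1 : ℝ) 1)
    hC.continuousOn
  have hMU0 : 0 ≤ MU := (norm_nonneg _).trans (hMU 0 (by norm_num))
  have hMC0 : 0 ≤ MC := (norm_nonneg _).trans (hMC 0 (by norm_num))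
  have hMR0 : 0 ≤ MR := (norm_nonneg _).trans (hMR 0 (by norm_num))
  refine ⟨MR * (2 * (MU * 2 ^ (n - 2) * MC)), fun t ht v hv => ?_⟩
  have hsq := Real.sq_sqrt ht.1
  have hst : √t ≤ 1 := Real.sqrt_le_one.2 ht.2
  have hv0 : 0 < v := hv.1
  have hvt : v ^ 2 < t := by rw [← hsq]; exact pow_lt_pow_left₀ hv.2 hv0.le two_ne_zero
  have hpos : 0 < 1 - t + v ^ 2 := by nlinarith [ht.2]
  have hterm : ∀ σ ∈ ({1, -1} : Finset ℝ), ‖σ ^ ℓ * U (√t - σ * v) * (√t - σ * v) ^ (n - 2) *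
      gegenbauer (((n : ℝ) - 2) / 2) ℓ ((√t * v + σ * (1 - t)) / √(1 - t + v ^ 2))‖ ≤
        MU * 2 ^ (n - 2) * MC := by
    intro σ hσ
    have hσ2 : σ ^ 2 = 1 := by
      rw [Finset.mem_insert, Finset.mem_singleton] at hσ
      rcases hσ with rfl | rfl <;> norm_num
    have hσ1 : |σ| = 1 := by
      rw [← sq_eq_sq₀ (abs_nonneg _) zero_le_one, sq_abs, hσ2, one_pow]
    have harg : √t - σ * v ∈ Icc (0 : ℝ) 2 := by
      rw [Finset.mem_insert, Finset.mem_singleton] at hσ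
      rcases hσ with rfl | rfl <;> constructor <;> linarith [hv.2]
    have hcos : (√t * v + σ * (1 - t)) / √(1 - t + v ^ 2) ∈ Icc (-1 : ℝ) 1 := by
      rw [mem_Icc, ← abs_le, abs_div, abs_of_pos (Real.sqrt_pos.2 hpos),
        div_le_one (Real.sqrt_pos.2 hpos)]
      apply Real.abs_le_sqrt
      -- The difference of the two sides is `(1-t) (v - σ √t)²`.
      have : 1 - t + v ^ 2 - (√t * v + σ * (1 - t)) ^ 2 = (1 - t) * (v - σ * √t) ^ 2 := by
        linear_combination (-v ^ 2 - (1 - t)  * σ ^ 2) * hsq  + (-(1 - t) ^ 2 - t * (1 - t)) * hσ2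
      nlinarith [mul_nonneg (sub_nonneg.2 ht.2) (sq_nonneg (v - σ * √t))]
    rw [norm_mul, norm_mul, norm_mul, norm_pow, norm_pow, Real.norm_eq_abs σ, hσ1, one_pow, one_mul]
    gcongr
    · exact hMU _ harg
    · rw [Real.norm_eq_abs, abs_of_nonneg harg.1]; exact harg.2
    · exact hMC _ hcos
  rw [abelIntegrand, norm_mul]
  gcongr
  · refine hMR _ ⟨Real.sqrt_nonneg _, Real.sqrt_le_one.2 (by linarith)⟩
  · refine (norm_sum_le_of_le _ hterm).trans ?_
    rw [Finset.sum_const, Finset.card_pair (by norm_num), nsmul_eq_mul]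
    norm_num

theorem continuousOn_abelIntegrand {n ℓ : ℕ} {U R : ℝ → ℝ} (hU : Continuous U)
    (hR : Continuous R) {t : ℝ} (ht : t ≤ 1) : ContinuousOn (abelIntegrand n U R ℓ t) (Ioi 0) := by
  have hC := continuous_gegenbauer (((n : ℝ) - 2) / 2) ℓ
  intro v hv
  have hv' : 0 < v := hv
  have hpos : √(1 - t + v ^ 2) ≠ 0 := (Real.sqrt_pos.2 (by nlinarith)).ne'
  apply ContinuousAt.continuousWithinAt
  unfold abelIntegrand
  fun_prop (disch := exact hpos)

theorem integrableOn_abelIntegrand {n ℓ : ℕ} {U R : ℝ → ℝ} (hU : Continuous U)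
    (hR : Continuous R) {t : ℝ} (ht : t ∈ Icc (0 : ℝ) 1) :
    IntegrableOn (abelIntegrand n U R ℓ t) (Ioo 0 √t) := by
  obtain ⟨M, hM⟩ := exists_abelIntegrand_bound (n := n) (ℓ := ℓ) hU hR
  refine Integrable.mono' (integrableOn_const (C := M) measure_Ioo_lt_top.ne) ?_ ?_
  · exact ((continuousOn_abelIntegrand hU hR ht.2).mono
      Ioo_subset_Ioi_self).aestronglyMeasurable measurableSet_Ioo
  · exact (ae_restrict_iff' measurableSet_Ioo).2 (Eventually.of_forall fun v hv => hM t ht v hv)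

theorem tendsto_integral_abelIntegrand {n ℓ : ℕ} {U R : ℝ → ℝ} (hU : Continuous U)
    (hR : Continuous R) :
    Tendsto (fun t => ∫ v in Ioo 0 √t, abelIntegrand n U R ℓ t v) (𝓝[<] 1)
      (𝓝 (∫ v in Ioo 0 √1, abelIntegrand n U R ℓ 1 v)) := by
  have hC := continuous_gegenbauer (((n : ℝ) - 2) / 2) ℓ
  obtain ⟨M, hM⟩ := exists_abelIntegrand_bound (n := n) (ℓ := ℓ) hU hR
  simp only [← integral_indicator measurableSet_Ioo]
  have hmem : ∀ᶠ t in 𝓝[<] (1 : ℝ), t ∈ Icc (0 : ℝ) 1 := by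
    filter_upwards [Ioo_mem_nhdsLT (zero_lt_one' ℝ)] with t ht using ⟨ht.1.le, ht.2.le⟩
  refine tendsto_integral_filter_of_dominated_convergence
    ((Ioo (0 : ℝ) 1).indicator fun _ => max M 0) ?_ ?_ ?_ ?_
  · filter_upwards [hmem] with t ht
    exact (aestronglyMeasurable_indicator_iff measurableSet_Ioo).2
      (integrableOn_abelIntegrand hU hR ht).aestronglyMeasurable
  · filter_upwards [hmem] with t ht
    refine Eventually.of_forall fun v => ?_
    by_cases hv : v ∈ Ioo 0 √t
    · have hv1 : v ∈ Ioo (0 : ℝ) 1 := ⟨hv.1, hv.2.trans_le (Real.sqrt_le_one.2 ht.2)⟩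
      rw [indicator_of_mem hv, indicator_of_mem hv1]
      exact (hM t ht v hv).trans (le_max_left _ _)
    · rw [indicator_of_notMem hv, norm_zero]
      exact indicator_nonneg (fun _ _ => le_max_right _ _) _
  · exact (integrable_indicator_iff measurableSet_Ioo).2 (integrableOn_const measure_Ioo_lt_top.ne)
  · refine Eventually.of_forall fun v => ?_
    by_cases hv : v ∈ Ioo (0 : ℝ) 1
    · rw [indicator_of_mem (by rwa [Real.sqrt_one])]
      have hlim : Tendsto (fun t => √t) (𝓝[<] (1 : ℝ)) (𝓝 1) := by
        have := (Real.continuous_sqrt.tendsto 1).mono_left (nhdsWithin_le_nhds (s := Iio (1 : ℝ)))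
        rwa [Real.sqrt_one] at this
      have hev : ∀ᶠ t in 𝓝[<] (1 : ℝ), abelIntegrand n U R ℓ t v =
          (Ioo 0 √t).indicator (abelIntegrand n U R ℓ t) v := by
        filter_upwards [hlim.eventually (lt_mem_nhds hv.2)] with t ht
        exact (indicator_of_mem (show v ∈ Ioo 0 √t from ⟨hv.1, ht⟩) _).symm
      refine Tendsto.congr' hev ?_
      have hpos : √(1 - 1 + v ^ 2) ≠ 0 :=
        (Real.sqrt_pos.2 (by rw [sub_self, zero_add]; exact pow_pos hv.1 2)).ne'
      have : ContinuousAt (fun t => abelIntegrand n U R ℓ t v) 1 := by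
        unfold abelIntegrand
        fun_prop (disch := exact hpos)
      exact this.tendsto.mono_left nhdsWithin_le_nhds
    · have hz : ∀ t ∈ Icc (0 : ℝ) 1, (Ioo 0 √t).indicator (abelIntegrand n U R ℓ t) v = 0 :=
        fun t ht => indicator_of_notMem
          (fun h => hv ⟨h.1, h.2.trans_le (Real.sqrt_le_one.2 ht.2)⟩) _
      rw [hz 1 (by norm_num)]
      refine tendsto_const_nhds.congr' ?_
      filter_upwards [hmem] with t ht using (hz t ht).symm

/-! ### The Abel-type equation -/

theorem image_sub_sq_Ioo {t : ℝ} (ht : 0 ≤ t) : (fun v => t - v ^ 2) '' Ioo 0 √t = Ioo 0 t := by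
  ext s
  constructor
  · rintro ⟨v, hv, rfl⟩
    have : v ^ 2 < t := by
      rw [← Real.sq_sqrt ht]; exact pow_lt_pow_left₀ hv.2 hv.1.le two_ne_zero
    have := pow_pos hv.1 2
    constructor <;> simp only <;> linarith
  · intro hs
    refine ⟨√(t - s), ⟨Real.sqrt_pos.2 (by linarith [hs.2]),
      Real.sqrt_lt_sqrt (by linarith [hs.2]) (by linarith [hs.1])⟩, ?_⟩
    simp only [Real.sq_sqrt (show 0 ≤ t - s by linarith [hs.2])]
    ring

theorem hasDerivWithinAt_sub_sq {t : ℝ} (S : Set ℝ) (v : ℝ) :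
    HasDerivWithinAt (fun v => t - v ^ 2) (-(2 * v)) S v := by
  simpa using ((hasDerivAt_pow 2 v).const_sub t).hasDerivWithinAt

theorem injOn_sub_sq (t : ℝ) : InjOn (fun v : ℝ => t - v ^ 2) (Ioo 0 √t) := by
  intro v hv w hw h
  have h' : v ^ 2 = w ^ 2 := by simpa using h
  exact (pow_left_inj₀ hv.1.le hw.1.le two_ne_zero).1 h'

/-- The integrand of the Abel equation under the substitution `s = t - v²`. -/
theorem abs_smul_abel_comp {n : ℕ} {Y : UnitSphere n → ℝ} {U V : ℝ → ℝ} {f : EucSp n → ℝ} {ℓ : ℕ}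
    (hV : ∀ r, 0 ≤ r → V r = U r) {t v : ℝ} (hv : v ∈ Ioo 0 √t) :
    |-(2 * v)| • (fHat Y f (t - v ^ 2) *
      (abelKernel n U ℓ t (t - v ^ 2) / √(t - (t - v ^ 2)))) =
      abelIntegrand n V (radialCoeff Y f) ℓ t v := by
  have hv0 : 0 < v := hv.1
  have e1 : t - (t - v ^ 2) = v ^ 2 := by ring
  have e2 : 1 - (t - v ^ 2) = 1 - t + v ^ 2 := by ring
  have h1 : V (√t - v) = U (√t - v) := hV _ (by linarith [hv.2])
  have h2 : V (√t + v) = U (√t + v) := hV _ (by linarith [hv.2])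
  rw [fHat, abelKernel, abelIntegrand, e1, e2, Real.sqrt_sq hv0.le, abs_neg,
    abs_of_pos (by linarith), smul_eq_mul, Finset.sum_pair (by norm_num),
    Finset.sum_pair (by norm_num), one_mul v, show √t - -1 * v = √t + v by ring, h1, h2]
  field_simp

theorem integrableOn_abel {n : ℕ} {Y : UnitSphere n → ℝ} {U V : ℝ → ℝ} {f : EucSp n → ℝ} {ℓ : ℕ}
    (hV : ∀ r, 0 ≤ r → V r = U r) (hVc : Continuous V) (hR : Continuous (radialCoeff Y f)) {t : ℝ}
    (ht : t ∈ Icc (0 : ℝ) 1) :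
    IntegrableOn (fun s => fHat Y f s * (abelKernel n U ℓ t s / √(t - s))) (Ioo 0 t) := by
  rw [← image_sub_sq_Ioo ht.1, integrableOn_image_iff_integrableOn_abs_deriv_smul measurableSet_Ioo
    (fun v _ => hasDerivWithinAt_sub_sq _ v) (injOn_sub_sq t)]
  exact (integrableOn_abelIntegrand hVc hR ht).congr_fun
    (fun v hv => (abs_smul_abel_comp hV hv).symm) measurableSet_Ioo

theorem integral_abel {n : ℕ} {Y : UnitSphere n → ℝ} {U V : ℝ → ℝ} {f : EucSp n → ℝ} {ℓ : ℕ}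
    (hV : ∀ r, 0 ≤ r → V r = U r) {t : ℝ} (ht : 0 ≤ t) :
    ∫ s in (0 : ℝ)..t, fHat Y f s * (abelKernel n U ℓ t s / √(t - s)) =
      ∫ v in Ioo 0 √t, abelIntegrand n V (radialCoeff Y f) ℓ t v := by
  rw [intervalIntegral.integral_of_le ht, integral_Ioc_eq_integral_Ioo, ← image_sub_sq_Ioo ht,
    integral_image_eq_integral_abs_deriv_smul measurableSet_Ioo
      (fun v _ => hasDerivWithinAt_sub_sq _ v) (injOn_sub_sq t)]
  exact setIntegral_congr_fun measurableSet_Ioo fun v hv => abs_smul_abel_comp hV hv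

theorem continuous_radialCoeff {n : ℕ} {Y : UnitSphere n → ℝ} (hY : Continuous Y)
    {f : EucSp n → ℝ} (hf : Continuous f) : Continuous (radialCoeff Y f) := by
  have hfin : IsFiniteMeasure (sphereMeasure n) := by unfold sphereMeasure; infer_instance
  unfold radialCoeff sphCoeff
  rw [← continuousOn_univ]
  refine continuousOn_integral_of_compact_support isCompact_univ (Continuous.continuousOn ?_)
    fun _ x _ hx => absurd (mem_univ x) hx
  simp only [Function.uncurry_def]
  fun_prop

theorem radialCoeff_eq_zero {n : ℕ} (Y : UnitSphere n → ℝ) {f : EucSp n → ℝ}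
    (hfb : ∀ x, 1 ≤ ‖x‖ → f x = 0) {ρ : ℝ} (hρ : 1 ≤ ρ) : radialCoeff Y f ρ = 0 := by
  have : ∀ θ : UnitSphere n, f (ρ • (θ : EucSp n)) = 0 := fun θ => by
    apply hfb
    rw [norm_smul, norm_eq_of_mem_sphere, mul_one]
    exact hρ.trans (le_abs_self ρ)
  simp [radialCoeff, sphCoeff, this]

theorem sphereArea_pos {n : ℕ} (hn : 2 ≤ n) : 0 < sphereArea (n - 1) := by
  rw [sphereArea, sphereMeasure, Measure.toSphere_real_apply_univ, finrank_euclideanSpace_fin]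
  have h1 : (0 : ℝ) < ((n - 1 : ℕ) : ℝ) := Nat.cast_pos.2 (by omega)
  have h2 : 0 < (volume : Measure (EucSp (n - 1))).real (Metric.ball 0 1) :=
    ENNReal.toReal_pos (Metric.measure_ball_pos _ _ one_pos).ne' measure_ball_lt_top.ne
  positivity

theorem conicalRadon_congr {n : ℕ} {U V : ℝ → ℝ} (hV : ∀ r, 0 ≤ r → V r = U r) (f : EucSp n → ℝ)
    (z : EucSp n) (ψ : ℝ) : conicalRadon U f z ψ = conicalRadon V f z ψ := by
  unfold conicalRadon
  simp only [hV _ (norm_nonneg _)]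

theorem gHat_eq_integral {n ℓ : ℕ} (hn : 2 ≤ n) {Y : UnitSphere n → ℝ}
    (hY : IsSphericalHarmonic n ℓ Y) {U V : ℝ → ℝ} (hV : ∀ r, 0 ≤ r → V r = U r)
    (hVc : Continuous V) {f : EucSp n → ℝ} (hf : Continuous f) (hfb : ∀ x, 1 ≤ ‖x‖ → f x = 0)
    (hR : Continuous (radialCoeff Y f)) {t : ℝ} (ht : t ∈ Ico (0 : ℝ) 1) :
    gHat Y U f t = ∫ v in Ioo 0 √t, abelIntegrand n V (radialCoeff Y f) ℓ t v := by
  have hst : √t < 1 := (Real.sqrt_lt' one_pos).2 (by simpa using ht.2)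
  have hcos : Real.cos (Real.arccos √t) = √t :=
    Real.cos_arccos (by linarith [Real.sqrt_nonneg t]) hst.le
  have hsin : Real.sin (Real.arccos √t) = √(1 - t) := by
    rw [Real.sin_arccos, Real.sq_sqrt ht.1]
  have h1t : 0 < 1 - t := by linarith [ht.2]
  have hcongr : radonCoeff Y U f (Real.arccos √t) = radonCoeff Y V f (Real.arccos √t) := by
    unfold radonCoeff
    simp only [conicalRadon_congr hV]
  have hpow : (1 - t) ^ (-((n : ℝ) - 2) / 2) * √(1 - t) ^ (n - 2) = 1 := by
    rw [Real.sqrt_eq_rpow, ← Real.rpow_natCast, ← Real.rpow_mul h1t.le, ← Real.rpow_add h1t,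
      Nat.cast_sub hn]
    convert Real.rpow_zero (1 - t) using 2
    push_cast
    ring
  rw [gHat, hcongr, radonCoeff_eq_integral_radial hn hY hVc hf hfb (Real.arccos_pos.2 hst)
    (Real.arccos_le_pi_div_two.2 (Real.sqrt_nonneg t)), hcos, hsin,
    ← integral_vertexIntegrand hVc hR (fun ρ => radialCoeff_eq_zero Y hfb) ht.1 ht.2]
  have hA := (sphereArea_pos hn).ne'
  change (sphereArea (n - 1))⁻¹ * _ * (_ * _ * ∫ r in Ioi (0 : ℝ),
    vertexIntegrand n V (radialCoeff Y f) ℓ t r) = _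
  generalize (∫ r in Ioi (0 : ℝ), vertexIntegrand n V (radialCoeff Y f) ℓ t r) = I
  calc _ = ((sphereArea (n - 1))⁻¹ * sphereArea (n - 1)) *
        ((1 - t) ^ (-((n : ℝ) - 2) / 2) * √(1 - t) ^ (n - 2)) * I := by ring
    _ = I := by rw [hpow, inv_mul_cancel₀ hA, one_mul, one_mul]

end

theorem proposition2p4 (n : ℕ) (hn : 2 ≤ n)
    (U : ℝ → ℝ) (hU : ContDiffOn ℝ ∞ U (Ici 0)) (hU0 : ∀ r, 0 ≤ r → 0 ≤ U r)
    (Y : (ℓ : ℕ) → Fin (numHarm n ℓ) → UnitSphere n → ℝ)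
    (hY : IsSphericalHarmonicBasis n Y)
    (f : EucSp n → ℝ) (hf : ContDiff ℝ ∞ f) (hfc : HasCompactSupport f)
    (hfb : tsupport f ⊆ Metric.ball 0 1)
    (ℓ : ℕ) (k : Fin (numHarm n ℓ)) :
    (∀ t ∈ Icc (0 : ℝ) 1, IntervalIntegrable
      (fun s => fHat (Y ℓ k) f s * (abelKernel n U ℓ t s / Real.sqrt (t - s))) volume 0 t) ∧
    (∀ t ∈ Ico (0 : ℝ) 1, gHat (Y ℓ k) U f t =
      ∫ s in (0 : ℝ)..t, fHat (Y ℓ k) f s * (abelKernel n U ℓ t s / Real.sqrt (t - s))) ∧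
    Tendsto (gHat (Y ℓ k) U f) (𝓝[<] 1)
      (𝓝 (∫ s in (0 : ℝ)..1,
        fHat (Y ℓ k) f s * (abelKernel n U ℓ 1 s / Real.sqrt (1 - s)))) := by
  have hYlk := hY.harmonic ℓ k
  have hYc : Continuous (Y ℓ k) := by
    obtain ⟨p, -, hp⟩ := hYlk
    rw [funext hp]
    exact (MvPolynomial.continuous_eval p).comp (by fun_prop)
  have hf0 : ∀ x, 1 ≤ ‖x‖ → f x = 0 := fun x hx => by
    by_contra h
    have := hfb (subset_tsupport f h)
    rw [mem_ball_zero_iff] at this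
    linarith
  have hR := continuous_radialCoeff hYc hf.continuous
  -- Only the values of `U` on `[0,∞)` matter, so `U` may be replaced by a continuous extension.
  set V : ℝ → ℝ := fun r => U (max r 0) with hVdef
  have hV : ∀ r, 0 ≤ r → V r = U r := fun r hr => by rw [hVdef]; simp only [max_eq_left hr]
  have hVc : Continuous V :=
    hU.continuousOn.comp_continuous (by fun_prop) fun r => le_max_right r 0
  have hg : ∀ t ∈ Ico (0 : ℝ) 1, gHat (Y ℓ k) U f t =
      ∫ v in Ioo 0 √t, abelIntegrand n V (radialCoeff (Y ℓ k) f) ℓ t v := fun t ht =>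
    gHat_eq_integral hn hYlk hV hVc hf.continuous hf0 hR ht
  refine ⟨fun t ht => ?_, fun t ht => ?_, ?_⟩
  · rw [intervalIntegrable_iff_integrableOn_Ioo_of_le ht.1]
    exact integrableOn_abel hV hVc hR ht
  · rw [hg t ht, integral_abel hV ht.1]
  · rw [integral_abel hV zero_le_one]
    refine (tendsto_integral_abelIntegrand hVc hR).congr' ?_
    filter_upwards [Ioo_mem_nhdsLT (zero_lt_one' ℝ)] with t ht
    exact (hg t ⟨ht.1.le, ht.2⟩).symm
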